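/- Let a quantum channel on a $d$-dimensional system be a map $\mathcal E(\rho)=\sum_i E_i\rho E_i^\dagger$ on $d\times d$ complex matrices, with finitely many Kraus operators satisfying $\sum_i E_i^\dagger E_i\le I$. Its unitarity is $\mathfrak u(\mathcal E)=\operatorname{tr}\big(\mathfrak J(\mathcal E)^2\big)$, where $\mathfrak J(\mathcal E)=(\mathcal E\otimes\mathcal I)(|\Phi\rangle\langle\Phi|)$ and $|\Phi\rangle=\frac1{\sqrt d}\sum_{i}|i\rangle|i\rangle$. A learning algorithm with incoherent access making $T$ calls to $\mathcal E$ is a rooted tree in which every root-to-leaf path has length $T$. At each inner node it prepares a density operator $\rho$ on the main system tensored with an ancilla of arbitrary finite dimension, applies $\mathcal E\otimes\mathcal I$ once, and measures a POVM $\{F_v\}_v$ with finitely many outcomes on both systems; outcome $v$ occurs with probability $\operatorname{tr}\big(F_v\,(\mathcal E\otimes\mathcal I)(\rho)\big)$ and leads to the $v$-th child. Each leaf carries a real number, the returned estimate. The ancilla, state and POVM may be different at each node, so they may depend on all previous outcomes. The whole tree may moreover depend on a classical random seed, drawn in advance from a probability space, such that for every channel the law of the estimate depends measurably on the seed. **Theorem.**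 There is an absolute constant $c>0$ such that the following holds for all integers $d\ge 2$, all real $\varepsilon$ with $0<\varepsilon<\frac12\left(1-\frac1{d^2}\right)$ and all integers $T\ge 0$. If a learning algorithm with incoherent access makes $T$ calls and, for every trace-preserving quantum channel $\mathcal E$ on a $d$-dimensional system, returns an estimate $z$ with $|z-\mathfrak u(\mathcal E)|\le\varepsilon$ with probability at least $2/3$, then $$T\;\ge\; c\left(\sqrt d+\varepsilon^{-2}\right).$$ In particular, any incoherent-access algorithm, even adaptive and ancilla-assisted, that estimates the unitarity of an unknown channel on a $d$-dimensional system to precision $\varepsilon$ in this range with probability at least $2/3$ needs $\Omega(\sqrt d+\varepsilon^{-2})$ calls. -/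

import Mathlib

open scoped ComplexOrder

noncomputable section

namespace UnitarityEstimation

/-- `d × d` complex matrices, the operators on a `d`-dimensional system. -/
abbrev Op (d : ℕ) : Type := Matrix (Fin d) (Fin d) ℂ

/-- Operators on the tensor product of a `d`-dimensional main system and an
`a`-dimensional ancilla system. -/
abbrev BiOp (d a : ℕ) : Type := Matrix (Fin d × Fin a) (Fin d × Fin a) ℂ

/-- A linear map `E` is a quantum channel (not necessarily trace-preserving) if
`E ρ = ∑ i, K i * ρ * (K i)ᴴ` for finitely many Kraus operators with `∑ i, (K i)ᴴ * K i ≤ 1`. -/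
def IsChannel {d : ℕ} (E : Op d →ₗ[ℂ] Op d) : Prop :=
  ∃ (m : ℕ) (K : Fin m → Op d),
    (∀ ρ : Op d, E ρ = ∑ i, K i * ρ * (K i).conjTranspose) ∧
      (1 - ∑ i, (K i).conjTranspose * K i).PosSemidef

/-- `E` preserves the trace. -/
def IsTracePreserving {d : ℕ} (E : Op d →ₗ[ℂ] Op d) : Prop :=
  ∀ ρ : Op d, (E ρ).trace = ρ.trace

/-- `(E ⊗ 𝓘) ρ`: the map `E` is applied to the main system and the ancilla is left untouched. -/
def applyMain {d a : ℕ} (E : Op d →ₗ[ℂ] Op d) (ρ : BiOp d a) : BiOp d a :=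
  Matrix.of fun p q => E (Matrix.of fun i j => ρ (i, p.2) (j, q.2)) p.1 q.1

/-- The maximally entangled vector `d^(-1/2) ∑ i, |i⟩|i⟩`. -/
def maxEntangled (d : ℕ) : Fin d × Fin d → ℂ :=
  fun p => if p.1 = p.2 then ((1 / Real.sqrt d : ℝ) : ℂ) else 0

/-- The Jamiołkowski state `(E ⊗ 𝓘)(|Φ⟩⟨Φ|)`. -/
def jamiolkowski {d : ℕ} (E : Op d →ₗ[ℂ] Op d) : BiOp d d :=
  applyMain E (Matrix.vecMulVec (maxEntangled d) (star (maxEntangled d)))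

/-- The unitarity of a channel: the purity `tr (J(E)²)` of its Jamiołkowski state. -/
def unitarity {d : ℕ} (E : Op d →ₗ[ℂ] Op d) : ℝ :=
  (jamiolkowski E * jamiolkowski E).trace.re

/-- One experiment: an ancilla dimension, a density operator on main system and ancilla, and a
POVM with finitely many outcomes on both systems. -/
structure Experiment (d : ℕ) where
  anc : ℕ
  state : BiOp d anc
  state_posSemidef : state.PosSemidef
  state_trace : state.trace = 1
  outcomes : ℕ
  povm : Fin outcomes → BiOp d anc
  povm_posSemidef : ∀ v, (povm v).PosSemidef
  povm_sum : ∑ v, povm v = 1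

/-- The probability of outcome `v` when the experiment is run with one call to `E`. -/
def Experiment.prob {d : ℕ} (e : Experiment d) (E : Op d →ₗ[ℂ] Op d) (v : Fin e.outcomes) : ℝ :=
  (e.povm v * applyMain E e.state).trace.re

/-- Adaptive incoherent-access strategies all of whose root-to-leaf paths contain exactly `T`
calls. At an inner node an experiment is run and its outcome selects the subtree in which the
strategy goes on, so that every choice may depend on all earlier outcomes; a leaf holds the
estimate that is returned. -/
inductive Strategy (d : ℕ) : ℕ → Type
  | leaf (estimate : ℝ) : Strategy d 0
  | node {T : ℕ} (e : Experiment d) (next : Fin e.outcomes → Strategy d T) : Strategy d (T + 1)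

open Classical in
/-- The probability that the returned estimate lies in `S` when all calls are made to `E`. -/
def Strategy.outputProb {d : ℕ} (E : Op d →ₗ[ℂ] Op d) (S : Set ℝ) :
    {T : ℕ} → Strategy d T → ℝ
  | _, .leaf z => if z ∈ S then 1 else 0
  | _, .node e next => ∑ v, e.prob E v * (next v).outputProb E S

/-- An incoherent-access algorithm with `T` calls: a strategy that may depend on a classical
random seed drawn in advance from an arbitrary probability space (a one-point space gives the
deterministic strategies). The law of the output is measurable in the seed. -/
structure IncoherentAlgorithm (d T : ℕ) where
  Seed : Type
  [measurableSpace : MeasurableSpace Seed]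
  law : MeasureTheory.Measure Seed
  [isProbability : MeasureTheory.IsProbabilityMeasure law]
  strategy : Seed → Strategy d T
  measurable_outputProb : ∀ E : Op d →ₗ[ℂ] Op d, IsChannel E → ∀ S : Set ℝ, MeasurableSet S →
    Measurable fun ω => (strategy ω).outputProb E S

/-- The probability that the estimate returned by the algorithm lies in `S` when it is run
with access to `E`. -/
def IncoherentAlgorithm.outputProb {d T : ℕ} (A : IncoherentAlgorithm d T)
    (E : Op d →ₗ[ℂ] Op d) (S : Set ℝ) : ℝ :=
  letI := A.measurableSpace
  ∫ ω, (A.strategy ω).outputProb E S ∂A.law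

/-- The algorithm estimates the unitarity to precision `ε` with probability at least `2/3`.
Success is demanded on trace-preserving channels only; an algorithm that succeeds on all
channels satisfies this in particular. -/
def IncoherentAlgorithm.EstimatesUnitarity {d T : ℕ} (A : IncoherentAlgorithm d T) (ε : ℝ) :
    Prop :=
  ∀ E : Op d →ₗ[ℂ] Op d, IsChannel E → IsTracePreserving E →
    2 / 3 ≤ A.outputProb E {z | |z - unitarity E| ≤ ε}

end UnitarityEstimation

end

open scoped ComplexOrder

namespace UnitarityEstimation

open Matrix MeasureTheory

/-! Two hypothesis tests give the two terms of the bound.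

For `√d`, the completely depolarizing channel (unitarity `1/d²`) is compared with a random unitary
channel (unitarity `1`); the range of `ε` makes the two sets of admissible estimates disjoint.
Expanding states and POVM elements into rank-one terms eliminates the ancillas. The probability of a
path then becomes a sum of terms `∏ |tr (U A_t)|²` for the unitary channel and `∏ ‖A_t‖² / d` for
the depolarizing one, with the same operators `A_t` and Frobenius norms. So a one-sided moment bound
suffices, `E_U ∏ |tr (U A_t)|² ≥ ∏ ‖A_t‖² / (d + t)` (`exists_unitary_design`): every event has
depolarizing probability at most `∏ (1 + t/d)` times its average unitary probability, and this
factor is less than `2` when `T² < d`.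

The moment bound needs no Weingarten calculus. On operators on the `n`-fold tensor power consider
the positive form `⟨Y, X⟩ = E_U tr (U^⊗n Y) conj (tr (U^⊗n X))`. By invariance, left multiplication
by `V^⊗n` has adjoint left multiplication by its conjugate transpose. The operators with this
property form an algebra, which therefore contains all symmetrized products. Let `C = ∑ Lᴴ L` over
the symmetrized products `L` of matrix units, and let `A` be the tensor product of the `A_t`. Then
`⟨C A, A⟩` is the average squared norm of the symmetrized product of the `A_t U`, hence at least `n!
∏ ‖A_t‖²`, because the permanent of a Gram matrix dominates its diagonal product. The row sums of
`C` are at most `n! ∏ (d + k)`, so `⟨C A, A⟩ ≤ n! ∏ (d + k) ⟨A, A⟩`. Comparing the two estimates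
gives the claim.

For `ε⁻²`, two mixtures of the identity and depolarizing channels whose weights differ by `3ε` are
compared. The likelihood ratio of an outcome deviates from `1` by `O(ε)` at every node, so its
second moment along a path is at most `(1 + O(ε²))^T`, and Cauchy–Schwarz bounds how far the two
output laws can differ. -/

/-! ### Tensor products of operators -/

/-- The tensor product of `n` operators, as a matrix indexed by tuples. -/
def tensorProd {n d : ℕ} (A : Fin n → Op d) : Matrix (Fin n → Fin d) (Fin n → Fin d) ℂ :=
  Matrix.of fun i j => ∏ t, A t (i t) (j t)

theorem tensorProd_apply {n d : ℕ} (A : Fin n → Op d) (i j : Fin n → Fin d) :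
    tensorProd A i j = ∏ t, A t (i t) (j t) := rfl

theorem tensorProd_mul {n d : ℕ} (A B : Fin n → Op d) :
    tensorProd A * tensorProd B = tensorProd fun t => A t * B t := by
  ext i j
  simp only [Matrix.mul_apply, tensorProd_apply, ← Finset.prod_mul_distrib]
  rw [Finset.prod_univ_sum, Fintype.piFinset_univ]

theorem trace_tensorProd {n d : ℕ} (A : Fin n → Op d) :
    (tensorProd A).trace = ∏ t, (A t).trace := by
  simp only [Matrix.trace, Matrix.diag, tensorProd_apply]
  rw [Finset.prod_univ_sum, Fintype.piFinset_univ]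

theorem conjTranspose_tensorProd {n d : ℕ} (A : Fin n → Op d) :
    (tensorProd A)ᴴ = tensorProd fun t => (A t)ᴴ := by
  ext i j
  simp [tensorProd_apply, Matrix.conjTranspose_apply]

/-! ### A finite design in place of Haar measure -/

theorem sum_eq_sum_of_embedding {ι κ M : Type*} [Fintype ι] [Fintype κ] [AddCommMonoid M]
    (f : ι ↪ κ) (g : κ → M) (g' : ι → M) (h1 : ∀ i, g (f i) = g' i)
    (h2 : ∀ k, (∀ i, f i ≠ k) → g k = 0) : ∑ k, g k = ∑ i, g' i := by
  rw [← Finset.sum_subset (Finset.subset_univ (Finset.univ.map f)), Finset.sum_map]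
  · exact Finset.sum_congr rfl fun i _ => h1 i
  · intro k _ hk
    exact h2 k fun i hi => hk (by simp [← hi])

/-- By Carathéodory, `finrank + 1` points always suffice, so the hull is a continuous image of a
simplex times a power of `s`. Shorter combinations are padded with weight `0` at a fixed point `x₀`.
-/
theorem isCompact_convexHull {E : Type*} [NormedAddCommGroup E] [NormedSpace ℝ E]
    [FiniteDimensional ℝ E] {s : Set E} (hs : IsCompact s) : IsCompact (convexHull ℝ s) := by
  classical
  rcases s.eq_empty_or_nonempty with rfl | ⟨x₀, hx₀⟩
  · simp
  let N := Module.finrank ℝ E + 1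
  have hK : IsCompact ((fun q : (Fin N → ℝ) × (Fin N → E) => ∑ k, q.1 k • q.2 k) ''
      (stdSimplex ℝ (Fin N) ×ˢ Set.pi Set.univ fun _ => s)) := by
    refine ((isCompact_stdSimplex ℝ (Fin N)).prod (isCompact_univ_pi fun _ => hs)).image ?_
    fun_prop
  convert hK using 1
  ext x
  constructor
  · intro hx
    obtain ⟨ι, _, z, w, hz, hind, hw, hw1, hsum⟩ := eq_pos_convex_span_of_mem_convexHull hx
    have hcard : Fintype.card ι ≤ Fintype.card (Fin N) := by
      simpa [N] using hind.card_le_finrank_succ.trans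
        (Nat.succ_le_succ (Submodule.finrank_le _))
    obtain ⟨f⟩ := Function.Embedding.nonempty_of_card_le hcard
    have hw' : ∀ i, Function.extend f w 0 (f i) = w i := fun i => f.injective.extend_apply _ _ i
    have hw0 : ∀ k, (∀ i, f i ≠ k) → Function.extend f w 0 k = 0 := fun k hk =>
      Function.extend_apply' _ _ _ fun ⟨i, hi⟩ => hk i hi
    have hz' : ∀ i, Function.extend f z (fun _ => x₀) (f i) = z i :=
      fun i => f.injective.extend_apply _ _ i
    have hz0 : ∀ k, (∀ i, f i ≠ k) → Function.extend f z (fun _ => x₀) k = x₀ := fun k hk =>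
      Function.extend_apply' _ _ _ fun ⟨i, hi⟩ => hk i hi
    refine ⟨(Function.extend f w 0, Function.extend f z fun _ => x₀), ⟨⟨fun k => ?_, ?_⟩, ?_⟩, ?_⟩
    · change 0 ≤ Function.extend f w 0 k
      by_cases hk : ∃ i, f i = k
      · obtain ⟨i, rfl⟩ := hk
        rw [hw']; exact (hw i).le
      · rw [hw0 k fun i hi => hk ⟨i, hi⟩]
    · rw [← hw1]; exact sum_eq_sum_of_embedding f _ _ hw' hw0
    · intro k _
      by_cases hk : ∃ i, f i = k
      · obtain ⟨i, rfl⟩ := hk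
        change Function.extend f z (fun _ => x₀) (f i) ∈ s
        rw [hz']; exact hz ⟨i, rfl⟩
      · change Function.extend f z (fun _ => x₀) k ∈ s
        rwa [hz0 k fun i hi => hk ⟨i, hi⟩]
    · rw [← hsum]
      refine sum_eq_sum_of_embedding f
        (fun k => Function.extend f w 0 k • Function.extend f z (fun _ => x₀) k) _
        (fun i => ?_) fun k hk => ?_
      · simp only [hw', hz']
      · simp only [hw0 k hk, zero_smul]
  · rintro ⟨⟨w, z⟩, ⟨⟨hw0, hw1⟩, hz⟩, rfl⟩
    exact (convex_convexHull ℝ s).sum_mem (fun k _ => hw0 k) hw1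
      fun k _ => subset_convexHull ℝ s (hz k trivial)

theorem isCompact_unitaryGroup (d : ℕ) :
    IsCompact (Matrix.unitaryGroup (Fin d) ℂ : Set (Op d)) := by
  have h : IsCompact (Set.pi Set.univ fun _ : Fin d => Set.pi Set.univ fun _ : Fin d =>
      Metric.closedBall (0 : ℂ) 1) :=
    isCompact_univ_pi fun _ => isCompact_univ_pi fun _ => isCompact_closedBall 0 1
  refine IsCompact.of_isClosed_subset
    (t := (Matrix.unitaryGroup (Fin d) ℂ : Set (Op d))) h (isClosed_unitary (R := Op d)) ?_
  intro U hU i _ j _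
  simpa using entry_norm_bound_of_unitary hU i j

/-- The Hermitian form `(Y, X) ↦ ∑ k, w k * tr (U k^⊗n * Y) * conj (tr (U k^⊗n * X))`. -/
noncomputable def momentForm {n d m : ℕ} (w : Fin m → ℝ) (U : Fin m → Op d)
    (Y X : Matrix (Fin n → Fin d) (Fin n → Fin d) ℂ) : ℂ :=
  ∑ k, (w k : ℂ) * ((tensorProd fun _ => U k) * Y).trace *
    star ((tensorProd fun _ => U k) * X).trace

/-- There is a finitely supported probability measure on the unitary group whose moments of
degree `(n, n)` are those of the Haar measure, expressed by invariance of the moment form. -/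
theorem exists_invariant_design (n d : ℕ) :
    ∃ (m : ℕ) (w : Fin m → ℝ) (U : Fin m → Op d), (∀ k, 0 ≤ w k) ∧ ∑ k, w k = 1 ∧
      (∀ k, U k ∈ Matrix.unitaryGroup (Fin d) ℂ) ∧
      ∀ V ∈ Matrix.unitaryGroup (Fin d) ℂ, ∀ Y X : Matrix (Fin n → Fin d) (Fin n → Fin d) ℂ,
        momentForm w U ((tensorProd fun _ => V) * Y) X =
          momentForm w U Y ((tensorProd fun _ => V)ᴴ * X) := by
  classical
  let G := Matrix.unitaryGroup (Fin d) ℂ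
  have : CompactSpace G := isCompact_iff_compactSpace.mp (isCompact_unitaryGroup d)
  let : MeasurableSpace G := borel G
  have : BorelSpace G := ⟨rfl⟩
  let μ : Measure G := Measure.haarMeasure ⊤
  have : IsProbabilityMeasure μ := ⟨by
    have := Measure.haarMeasure_self (G := G) (K₀ := ⊤)
    simpa [μ] using this⟩
  -- `Φ U` lists all degree `(n, n)` monomials in the entries of `Uᴴ`. Its Haar average lies in the
  -- compact convex hull of its range, hence is a finite convex combination of values. The adjoint
  -- is used so that left invariance of Haar measure acts on the side of `U` next to `Y` and `X` in
  -- the traces.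
  let Φ : G → (((Fin n → Fin d) × (Fin n → Fin d)) × ((Fin n → Fin d) × (Fin n → Fin d)) → ℂ) := fun U p =>
    tensorProd (fun _ => (U : Op d)ᴴ) p.1.1 p.1.2 *
      star (tensorProd (fun _ => (U : Op d)ᴴ) p.2.1 p.2.2)
  have hΦ : Continuous Φ := by
    refine continuous_pi fun p => ?_
    have h : ∀ i j : Fin n → Fin d, Continuous fun U : G => tensorProd (fun _ => (U : Op d)ᴴ) i j := by
      intro i j
      simp only [tensorProd_apply, Matrix.conjTranspose_apply]
      refine continuous_finsetProd _ fun t _ => ?_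
      exact (continuous_subtype_val.matrix_elem _ _).star
    exact (h _ _).mul (h _ _).star
  have hint : Integrable Φ μ := hΦ.integrable_of_hasCompactSupport (HasCompactSupport.of_compactSpace _)
  have hcl : IsClosed (convexHull ℝ (Set.range Φ)) :=
    (isCompact_convexHull (isCompact_range hΦ)).isClosed
  have hmem : (∫ U, Φ U ∂μ) ∈ convexHull ℝ (Set.range Φ) :=
    (convex_convexHull ℝ _).integral_mem hcl
      (Filter.Eventually.of_forall fun U => subset_convexHull ℝ _ ⟨U, rfl⟩) hint
  rw [mem_convexHull_iff_exists_fintype] at hmem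
  obtain ⟨ι, _, w, z, hw0, hw1, hz, hsum⟩ := hmem
  choose u hu using hz
  let e := Fintype.equivFin ι
  -- pairing of a moment vector with two tensors
  let pair : Matrix (Fin n → Fin d) (Fin n → Fin d) ℂ → Matrix (Fin n → Fin d) (Fin n → Fin d) ℂ →
       (((Fin n → Fin d) × (Fin n → Fin d)) × ((Fin n → Fin d) × (Fin n → Fin d)) → ℂ) →L[ℝ] ℂ := fun Y X =>
    ∑ p : ((Fin n → Fin d) × (Fin n → Fin d)) × ((Fin n → Fin d) × (Fin n → Fin d)), ((Y p.1.2 p.1.1 * star (X p.2.2 p.2.1)) •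
      (ContinuousLinearMap.proj (R := ℝ) (φ := fun _ => ℂ) p))
  have hpair : ∀ (Y X : Matrix (Fin n → Fin d) (Fin n → Fin d) ℂ) (U : G), pair Y X (Φ U) =
      ((tensorProd fun _ => (U : Op d)ᴴ) * Y).trace *
        star ((tensorProd fun _ => (U : Op d)ᴴ) * X).trace := by
    intro Y X U
    simp only [pair, Φ, _root_.sum_apply, _root_.smul_apply,
      ContinuousLinearMap.proj_apply, smul_eq_mul, Matrix.trace, Matrix.diag, Matrix.mul_apply,
      star_sum, star_mul']
    rw [Fintype.sum_prod_type, Fintype.sum_prod_type, Finset.sum_mul]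
    refine Finset.sum_congr rfl fun i _ => ?_
    rw [Finset.sum_mul]
    refine Finset.sum_congr rfl fun j _ => ?_
    rw [Fintype.sum_prod_type, Finset.mul_sum]
    refine Finset.sum_congr rfl fun k _ => ?_
    rw [Finset.mul_sum]
    refine Finset.sum_congr rfl fun l _ => ?_
    ring
  have hform : ∀ Y X : Matrix (Fin n → Fin d) (Fin n → Fin d) ℂ, momentForm (fun k => w (e.symm k)) (fun k => ((u (e.symm k) : G) : Op d)ᴴ) Y X =
      ∫ U, pair Y X (Φ U) ∂μ := by
    intro Y X
    rw [ContinuousLinearMap.integral_comp_comm _ hint, ← hsum, map_sum, momentForm]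
    rw [← e.symm.sum_comp (fun k => pair Y X (w k • z k))]
    refine Finset.sum_congr rfl fun k _ => ?_
    rw [map_smul, ← hu, hpair, Complex.real_smul, mul_assoc]
  refine ⟨Fintype.card ι, fun k => w (e.symm k), fun k => ((u (e.symm k) : G) : Op d)ᴴ,
    fun k => hw0 _, ?_, fun k => ?_, ?_⟩
  · rw [← hw1]; exact e.symm.sum_comp w
  · exact (star (u (e.symm k))).2
  · intro V hV Y X
    rw [hform, hform]
    -- Replacing `U` by `V U` turns `Uᴴ` into `Uᴴ Vᴴ`, which cancels the `V` in front of `Y` and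
    -- puts `Vᴴ` in front of `X`.
    rw [← integral_mul_left_eq_self (fun U => pair ((tensorProd fun _ => V) * Y) X (Φ U)) (⟨V, hV⟩ : G)]
    refine integral_congr_ae (Filter.Eventually.of_forall fun U => ?_)
    have h1 : Vᴴ * V = 1 := Matrix.mem_unitaryGroup_iff'.mp hV
    simp only [hpair]
    rw [conjTranspose_tensorProd]
    simp only [← Matrix.mul_assoc, tensorProd_mul, Submonoid.coe_mul, Matrix.conjTranspose_mul]
    simp only [Matrix.mul_assoc, h1, Matrix.mul_one]

/-! ### The algebra generated by tensor powers of unitaries -/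

/-- The sum over all permutations of the factors of a tensor product. -/
def symProd {n d : ℕ} (A : Fin n → Op d) : Matrix (Fin n → Fin d) (Fin n → Fin d) ℂ :=
  ∑ σ : Equiv.Perm (Fin n), tensorProd fun t => A (σ t)

theorem symProd_apply {n d : ℕ} (A : Fin n → Op d) (i j : Fin n → Fin d) :
    symProd A i j = ∑ σ : Equiv.Perm (Fin n), ∏ t, A (σ t) (i t) (j t) := by
  simp [symProd, Matrix.sum_apply, tensorProd_apply]

/-- A matrix-valued polynomial that takes values in a subspace at infinitely many points takes
all its values there. -/
theorem mem_of_infinite_mem {ι : Type*} [Fintype ι] (S : Submodule ℂ (Matrix ι ι ℂ))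
    (P : ι → ι → Polynomial ℂ) {s : Set ℂ} (hs : s.Infinite)
    (h : ∀ z ∈ s, (Matrix.of fun i j => (P i j).eval z) ∈ S) (z : ℂ) :
    (Matrix.of fun i j => (P i j).eval z) ∈ S := by
  classical
  by_contra hz
  -- A functional vanishing on `S` but not at the given point would yield a nonzero polynomial with
  -- infinitely many roots.
  obtain ⟨φ, hφz, hφ⟩ := Submodule.exists_le_ker_of_notMem hz
  let q : Polynomial ℂ := ∑ i, ∑ j, Polynomial.C (φ (Matrix.single i j 1)) * P i j
  have hq : ∀ x, q.eval x = φ (Matrix.of fun i j => (P i j).eval x) := by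
    intro x
    rw [Matrix.matrix_eq_sum_single (Matrix.of fun i j => (P i j).eval x)]
    simp only [q, Polynomial.eval_finsetSum, Polynomial.eval_mul, Polynomial.eval_C, map_sum,
      Matrix.of_apply]
    refine Finset.sum_congr rfl fun i _ => Finset.sum_congr rfl fun j _ => ?_
    have : Matrix.single i j ((P i j).eval x) = (P i j).eval x • Matrix.single i j (1 : ℂ) := by
      simp [Matrix.smul_single]
    rw [this, map_smul, smul_eq_mul, mul_comm]
  have hq0 : q = 0 := Polynomial.eq_zero_of_infinite_isRoot q
    (hs.mono fun x hx => by
      change q.eval x = 0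
      rw [hq]; exact hφ (h x hx))
  exact hφz (by rw [← hq, hq0, Polynomial.eval_zero])

theorem infinite_unit_circle : {z : ℂ | ‖z‖ = 1}.Infinite := by
  have h : Set.InjOn (fun x : ℝ => Complex.exp (x * Complex.I)) (Set.Icc 0 1) := by
    intro x hx y hy hxy
    obtain ⟨k, hk⟩ := Complex.exp_eq_exp_iff_exists_int.mp hxy
    have h1 : (x : ℂ) = y + k * (2 * Real.pi) := by
      have := Complex.I_ne_zero
      apply mul_right_cancel₀ this
      linear_combination hk
    have h2 : x = y + k * (2 * Real.pi) := by exact_mod_cast h1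
    have hk0 : k = 0 := by
      by_contra hne
      have : (1 : ℝ) ≤ |(k : ℝ)| := by exact_mod_cast Int.one_le_abs hne
      have h3 : |(k : ℝ)| * (2 * Real.pi) ≤ 1 := by
        rw [← abs_of_pos Real.two_pi_pos, ← abs_mul]
        rw [abs_le]; constructor <;> linarith [hx.1, hx.2, hy.1, hy.2]
      nlinarith [Real.pi_gt_three]
    rw [h2, hk0]; simp
  refine ((Set.Icc_infinite (zero_lt_one' ℝ)).image h).mono ?_
  rintro _ ⟨x, _, rfl⟩
  exact Complex.norm_exp_ofReal_mul_I x

section Span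

variable {n d : ℕ} (S : Submodule ℂ (Matrix (Fin n → Fin d) (Fin n → Fin d) ℂ))

/-- Diagonal matrices with unimodular entries are unitary. The entries are freed from the unit
circle one at a time, each by polynomial continuation. -/
theorem tensorProd_diagonal_mem
    (hU : ∀ V ∈ Matrix.unitaryGroup (Fin d) ℂ, (tensorProd fun _ => V) ∈ S) (z : Fin d → ℂ) :
    (tensorProd fun _ => Matrix.diagonal z) ∈ S := by
  classical
  suffices H : ∀ s : Finset (Fin d), ∀ z : Fin d → ℂ, (∀ a, a ∉ s → ‖z a‖ = 1) →
      (tensorProd fun _ => Matrix.diagonal z) ∈ S from H Finset.univ z (by simp)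
  intro s
  induction s using Finset.induction_on with
  | empty =>
    intro z hz
    refine hU _ ?_
    rw [Matrix.mem_unitaryGroup_iff, Matrix.star_eq_conjTranspose, Matrix.diagonal_conjTranspose,
      Matrix.diagonal_mul_diagonal, ← Matrix.diagonal_one]
    congr 1
    ext a
    have h := Complex.mul_conj (z a)
    rw [Complex.normSq_eq_norm_sq, hz a (by simp)] at h
    simpa using h
  | insert a s ha ih =>
    intro z hz
    let P : (Fin n → Fin d) → (Fin n → Fin d) → Polynomial ℂ := fun i j =>
      ∏ t, if i t = j t then (if i t = a then Polynomial.X else Polynomial.C (z (i t))) else 0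
    have hP : ∀ x : ℂ, (Matrix.of fun i j => (P i j).eval x) =
        tensorProd fun _ => Matrix.diagonal (Function.update z a x) := by
      intro x
      ext i j
      simp only [Matrix.of_apply, P, Polynomial.eval_prod, tensorProd_apply]
      refine Finset.prod_congr rfl fun t _ => ?_
      rw [Matrix.diagonal_apply, Function.update_apply]
      split_ifs <;> simp
    have := mem_of_infinite_mem S P infinite_unit_circle (fun x hx => ?_) (z a)
    · rwa [hP, Function.update_eq_self] at this
    · rw [hP]
      refine ih _ fun b hb => ?_
      rw [Function.update_apply]
      split_ifs with hba
      · exact hx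
      · exact hz b (by simp [hba, hb])

theorem tensorProd_isHermitian_mem (hmul : ∀ L ∈ S, ∀ L' ∈ S, L * L' ∈ S)
    (hU : ∀ V ∈ Matrix.unitaryGroup (Fin d) ℂ, (tensorProd fun _ => V) ∈ S) {H : Op d}
    (hH : H.IsHermitian) : (tensorProd fun _ => H) ∈ S := by
  have h := hH.spectral_theorem
  rw [Unitary.conjStarAlgAut_apply] at h
  have h2 : (tensorProd fun _ : Fin n => H) =
      (tensorProd fun _ => (hH.eigenvectorUnitary : Op d)) *
      (tensorProd fun _ => Matrix.diagonal (RCLike.ofReal ∘ hH.eigenvalues)) *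
      (tensorProd fun _ => star (hH.eigenvectorUnitary : Op d)) := by
    rw [tensorProd_mul, tensorProd_mul]
    congr 1
    funext _
    exact h
  rw [h2]
  refine hmul _ (hmul _ (hU _ hH.eigenvectorUnitary.2) _ (tensorProd_diagonal_mem S hU _)) _ ?_
  exact hU _ (star hH.eigenvectorUnitary).2

/-- Write `B = H₁ + i H₂` with Hermitian parts. The power of `H₁ + x H₂` is polynomial in `x` and
lies in `S` for real `x`, hence also at `x = i`. -/
theorem tensorProd_const_mem (hmul : ∀ L ∈ S, ∀ L' ∈ S, L * L' ∈ S)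
    (hU : ∀ V ∈ Matrix.unitaryGroup (Fin d) ℂ, (tensorProd fun _ => V) ∈ S) (B : Op d) :
    (tensorProd fun _ => B) ∈ S := by
  obtain ⟨H₁, H₂, h₁, h₂, rfl⟩ : ∃ H₁ H₂ : Op d, H₁.IsHermitian ∧ H₂.IsHermitian ∧
      B = H₁ + Complex.I • H₂ := by
    refine ⟨realPart B, imaginaryPart B, (realPart B).2, (imaginaryPart B).2, ?_⟩
    exact (realPart_add_I_smul_imaginaryPart B).symm
  let P : (Fin n → Fin d) → (Fin n → Fin d) → Polynomial ℂ := fun i j =>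
    ∏ t, (Polynomial.C (H₁ (i t) (j t)) + Polynomial.X * Polynomial.C (H₂ (i t) (j t)))
  have hP : ∀ x : ℂ, (Matrix.of fun i j => (P i j).eval x) =
      tensorProd fun _ => H₁ + x • H₂ := by
    intro x
    ext i j
    simp [P, Polynomial.eval_prod, tensorProd_apply, mul_comm x]
  rw [← hP]
  refine mem_of_infinite_mem S P (s := Set.range ((↑) : ℝ → ℂ))
    (Set.infinite_range_of_injective Complex.ofReal_injective) ?_ _
  rintro _ ⟨x, rfl⟩
  rw [hP]
  refine tensorProd_isHermitian_mem S hmul hU (h₁.add ?_)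
  rw [Matrix.IsHermitian, Matrix.conjTranspose_smul, h₂.eq]
  simp

/-- Flipping the sign at an index missed by `f` changes the first product and not the second, so the
terms cancel in pairs. -/
theorem sum_sign_prod (f : Fin n → Fin n) (hf : ¬ Function.Surjective f) :
    ∑ ε : Fin n → ℤˣ, ((∏ t, ε t : ℤˣ) : ℂ) * ((∏ t, ε (f t) : ℤˣ) : ℂ) = 0 := by
  classical
  obtain ⟨s, hs⟩ := not_forall.mp hf
  have hs' : ∀ t, f t ≠ s := fun t ht => hs ⟨t, ht⟩
  have hinv : Function.Involutive fun ε : Fin n → ℤˣ => Function.update ε s (-ε s) := by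
    intro ε
    simp
  have h := Equiv.sum_comp (hinv.toPerm _)
    fun ε : Fin n → ℤˣ => ((∏ t, ε t : ℤˣ) : ℂ) * ((∏ t, ε (f t) : ℤˣ) : ℂ)
  have h2 : ∀ ε : Fin n → ℤˣ, (((∏ t, hinv.toPerm _ ε t : ℤˣ) : ℂ) *
      ((∏ t, hinv.toPerm _ ε (f t) : ℤˣ) : ℂ)) =
      - (((∏ t, ε t : ℤˣ) : ℂ) * ((∏ t, ε (f t) : ℤˣ) : ℂ)) := by
    intro ε
    have e1 : ∏ t, Function.update ε s (-ε s) t = - ∏ t, ε t := by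
      rw [Finset.prod_update_of_mem (Finset.mem_univ s), neg_mul,
        ← Finset.mul_prod_erase _ _ (Finset.mem_univ s), Finset.sdiff_singleton_eq_erase]
    have e2 : ∀ t, Function.update ε s (-ε s) (f t) = ε (f t) := fun t =>
      Function.update_of_ne (hs' t) _ _
    simp only [Function.Involutive.coe_toPerm, e1, e2]
    push_cast
    ring
  simp only [h2, Finset.sum_neg_distrib] at h
  linear_combination (-1 / 2 : ℂ) * h

/-- Polarization: symmetrized tensor products are combinations of tensor powers. -/
theorem sum_sign_smul_tensorProd (A : Fin n → Op d) :
    ∑ ε : Fin n → ℤˣ, ((∏ t, ε t : ℤˣ) : ℂ) •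
      (tensorProd fun _ : Fin n => ∑ s, ((ε s : ℤˣ) : ℂ) • A s) = (2 ^ n : ℂ) • symProd A := by
  classical
  ext i j
  simp only [Matrix.sum_apply, Matrix.smul_apply, tensorProd_apply, smul_eq_mul, symProd_apply]
  simp only [Finset.prod_univ_sum, Fintype.piFinset_univ, Finset.prod_mul_distrib, Finset.mul_sum]
  rw [Finset.sum_comm]
  -- Multiplying out the powers gives a sum over all maps `f : Fin n → Fin n`; only the permutations
  -- survive the sum over signs.
  refine sum_eq_sum_of_embedding (⟨fun σ => σ, DFunLike.coe_injective⟩ :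
    Equiv.Perm (Fin n) ↪ (Fin n → Fin n)) _ _ (fun σ => ?_) fun f hf => ?_
  · have : ∀ ε : Fin n → ℤˣ, ((∏ t, ε t : ℤˣ) : ℂ) * ∏ t, ((ε (σ t) : ℤˣ) : ℂ) = 1 := by
      intro ε
      rw [Equiv.prod_comp σ (fun t => ((ε t : ℤˣ) : ℂ))]
      push_cast
      rw [← Finset.prod_mul_distrib]
      refine Finset.prod_eq_one fun t _ => ?_
      rcases Int.units_eq_one_or (ε t) with h | h <;> simp [h]
    simp only [Function.Embedding.coeFn_mk, ← mul_assoc, this, one_mul, Finset.sum_const,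
      Finset.card_univ, Fintype.card_fun, Fintype.card_units_int, Fintype.card_fin, nsmul_eq_mul]
    norm_num
  · have hns : ¬ Function.Surjective f := fun h =>
      hf (Equiv.ofBijective f (Finite.surjective_iff_bijective.mp h)) rfl
    simp only [← mul_assoc, ← Finset.sum_mul]
    have := sum_sign_prod f hns
    push_cast at this
    push_cast
    rw [this, zero_mul]

theorem symProd_mem (hmul : ∀ L ∈ S, ∀ L' ∈ S, L * L' ∈ S)
    (hU : ∀ V ∈ Matrix.unitaryGroup (Fin d) ℂ, (tensorProd fun _ => V) ∈ S) (A : Fin n → Op d) :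
    symProd A ∈ S := by
  have h : symProd A = (2 ^ n : ℂ)⁻¹ • ((2 ^ n : ℂ) • symProd A) := by
    rw [smul_smul, inv_mul_cancel₀ (by positivity), one_smul]
  rw [h, ← sum_sign_smul_tensorProd]
  exact S.smul_mem _ (S.sum_mem fun ε _ => S.smul_mem _ (tensorProd_const_mem S hmul hU _))

end Span

/-- The matrices `L` whose adjoint with respect to the moment form is `Lᴴ`. -/
def adjointable {n d m : ℕ} (w : Fin m → ℝ) (U : Fin m → Op d) :
    Submodule ℂ (Matrix (Fin n → Fin d) (Fin n → Fin d) ℂ) where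
  carrier := {L | ∀ Y X, momentForm w U (L * Y) X = momentForm w U Y (Lᴴ * X)}
  add_mem' := by
    intro L L' h h' Y X
    have e1 : momentForm w U ((L + L') * Y) X =
        momentForm w U (L * Y) X + momentForm w U (L' * Y) X := by
      simp only [momentForm, Matrix.trace_add, mul_add, add_mul,
        Finset.sum_add_distrib]
    have e2 : momentForm w U Y ((L + L')ᴴ * X) =
        momentForm w U Y (Lᴴ * X) + momentForm w U Y (L'ᴴ * X) := by
      simp only [momentForm, Matrix.conjTranspose_add, Matrix.add_mul,
        Matrix.trace_add, star_add, mul_add, Finset.sum_add_distrib]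
    rw [e1, e2, h, h']
  zero_mem' := by
    intro Y X
    simp [momentForm]
  smul_mem' := by
    intro c L h Y X
    have e1 : momentForm w U ((c • L) * Y) X = c * momentForm w U (L * Y) X := by
      simp only [momentForm, Matrix.smul_mul, Matrix.mul_smul, Matrix.trace_smul, smul_eq_mul,
        Finset.mul_sum]
      exact Finset.sum_congr rfl fun k _ => by ring
    have e2 : momentForm w U Y ((c • L)ᴴ * X) = c * momentForm w U Y (Lᴴ * X) := by
      simp only [momentForm, Matrix.conjTranspose_smul, Matrix.smul_mul, Matrix.mul_smul,
        Matrix.trace_smul, smul_eq_mul, Finset.mul_sum, star_mul', star_star]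
      exact Finset.sum_congr rfl fun k _ => by ring
    rw [e1, e2, h]

theorem mul_mem_adjointable {n d m : ℕ} {w : Fin m → ℝ} {U : Fin m → Op d}
    {L L' : Matrix (Fin n → Fin d) (Fin n → Fin d) ℂ} (h : L ∈ adjointable w U)
    (h' : L' ∈ adjointable w U) : L * L' ∈ adjointable w U := by
  intro Y X
  rw [Matrix.mul_assoc, h, h', Matrix.conjTranspose_mul, Matrix.mul_assoc]

/-! ### Symmetrized products of vectors and the permanent inequality -/

section SymmetricProduct

variable {n : ℕ} {N : Type*}

/-- The tensor product of vectors, as a function of tuples. -/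
def prodFun (b : Fin n → N → ℂ) (t : Fin n → N) : ℂ := ∏ x, b x (t x)

/-- The symmetrized tensor product of vectors, as a function of tuples. -/
def symFun (b : Fin n → N → ℂ) (t : Fin n → N) : ℂ :=
  ∑ σ : Equiv.Perm (Fin n), prodFun b (t ∘ σ)

theorem symFun_comp_perm (b : Fin n → N → ℂ) (t : Fin n → N) (ρ : Equiv.Perm (Fin n)) :
    symFun b (t ∘ ρ) = symFun b t :=
  Equiv.sum_comp (Equiv.mulLeft ρ) fun σ => prodFun b (t ∘ σ)

/-- Symmetrization is `n!` times a self-adjoint projection, which fixes the symmetric function `F`.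
-/
theorem sum_star_symFun_mul [Fintype N] (b : Fin n → N → ℂ) (F : (Fin n → N) → ℂ)
    (hF : ∀ t (σ : Equiv.Perm (Fin n)), F (t ∘ σ) = F t) :
    ∑ t, star (symFun b t) * F t = n.factorial * ∑ t, star (prodFun b t) * F t := by
  simp only [symFun, star_sum, Finset.sum_mul]
  rw [Finset.sum_comm]
  have h : ∀ σ : Equiv.Perm (Fin n), ∑ t, star (prodFun b (t ∘ σ)) * F t =
      ∑ t, star (prodFun b t) * F t := by
    intro σ
    rw [← Equiv.sum_comp (Equiv.arrowCongr σ (Equiv.refl N))]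
    refine Finset.sum_congr rfl fun t _ => ?_
    have : (Equiv.arrowCongr σ (Equiv.refl N)) t = t ∘ σ.symm := rfl
    rw [this, hF]
    congr 3
    ext x
    simp
  simp only [h, Finset.sum_const, Finset.card_univ, Fintype.card_perm, Fintype.card_fin,
    nsmul_eq_mul]

/-- Permutations are sorted by the image of `0`. Either the vector `a 0` receives `y`, or it
receives some `t r`, and then `y` takes the place of `t r`. -/
theorem symFun_cons [DecidableEq N] (a : Fin (n + 1) → N → ℂ) (y : N) (t : Fin n → N) :
    symFun a (Fin.cons y t : Fin (n + 1) → N) = a 0 y * symFun (fun x => a x.succ) t +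
      ∑ r, a 0 (t r) * symFun (fun x => a x.succ) (Function.update t r y) := by
  have h := Equiv.sum_comp (Equiv.Perm.decomposeFin (n := n)).symm
    fun σ => prodFun a ((Fin.cons y t : Fin (n + 1) → N) ∘ σ)
  rw [symFun, ← h, Fintype.sum_prod_type, Fin.sum_univ_succ]
  simp only [symFun, Finset.mul_sum, prodFun]
  congr 1
  · refine Finset.sum_congr rfl fun e _ => ?_
    rw [Fin.prod_univ_succ]
    simp
  · refine Finset.sum_congr rfl fun r _ => Finset.sum_congr rfl fun e _ => ?_
    rw [Fin.prod_univ_succ]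
    refine congrArg₂ (· * ·) (by simp) ?_
    · refine Finset.prod_congr rfl fun x _ => ?_
      congr 1
      simp only [Function.comp_apply, Equiv.Perm.decomposeFin_symm_apply_succ]
      by_cases hx : e x = r
      · rw [hx, Equiv.swap_apply_right, Fin.cons_zero, Function.update_self]
      · rw [Equiv.swap_apply_of_ne_of_ne (Fin.succ_ne_zero _) (fun h => hx (Fin.succ_injective _ h)),
          Fin.cons_succ, Function.update_of_ne hx]

/-- The sum is the squared norm of `w` contracted with `a` in slot `r`. -/
theorem exists_nonneg_contraction [Fintype N] [DecidableEq N] (w : (Fin n → N) → ℂ) (a : N → ℂ)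
    (r : Fin n) : ∃ s : ℝ, 0 ≤ s ∧
      ∑ t, star (w t) * (a (t r) * ∑ y, star (a y) * w (Function.update t r y)) = s := by
  let e := Equiv.funSplitAt r N
  have hr : ∀ z s, e.symm (z, s) r = z := by
    intro z s
    simp [e]
  have hu : ∀ z s y, Function.update (e.symm (z, s)) r y = e.symm (y, s) := by
    intro z s y
    ext x
    by_cases hx : x = r
    · subst hx; rw [Function.update_self, hr]
    · simp [e, hx]
  refine ⟨∑ s, ‖∑ y, star (a y) * w (e.symm (y, s))‖ ^ 2, by positivity, ?_⟩
  rw [← Equiv.sum_comp e.symm, Fintype.sum_prod_type, Finset.sum_comm]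
  push_cast
  refine Finset.sum_congr rfl fun s _ => ?_
  simp only [hr, hu]
  rw [← Complex.conj_mul', map_sum, Finset.sum_mul]
  refine Finset.sum_congr rfl fun z _ => ?_
  simp only [map_mul, ← starRingEnd_apply, Complex.conj_conj]
  ring

/-- The squared norm of a symmetrized product of vectors is at least the product of the squared
norms: the permanent of a Gram matrix is at least the product of its diagonal. -/
theorem prod_norm_sq_le_inner_symFun [Fintype N] [DecidableEq N] (a : Fin n → N → ℂ) :
    ∃ q : ℝ, ∏ x, ∑ z, ‖a x z‖ ^ 2 ≤ q ∧ ∑ t, star (prodFun a t) * symFun a t = q := by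
  induction n with
  | zero => exact ⟨1, by simp, by simp [prodFun, symFun]⟩
  | succ n ih =>
    obtain ⟨q, hq, hqe⟩ := ih fun x => a x.succ
    choose s hs0 hs using exists_nonneg_contraction (symFun fun x : Fin n => a x.succ) (a 0)
    -- The two terms are those of `symFun_cons`. The cross terms pair `prodFun` with the symmetric
    -- function `G`; passing to `symFun` turns them into the nonnegative contractions `s r` and
    -- costs the factor `1/n!`.
    refine ⟨(∑ z, ‖a 0 z‖ ^ 2) * q + (n.factorial : ℝ)⁻¹ * ∑ r, s r, ?_, ?_⟩
    · rw [Fin.prod_univ_succ]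
      have h1 : (∑ z, ‖a 0 z‖ ^ 2) * ∏ x : Fin n, ∑ z, ‖a x.succ z‖ ^ 2 ≤
          (∑ z, ‖a 0 z‖ ^ 2) * q := mul_le_mul_of_nonneg_left hq (by positivity)
      have h2 : 0 ≤ (n.factorial : ℝ)⁻¹ * ∑ r, s r :=
        mul_nonneg (by positivity) (Finset.sum_nonneg fun r _ => hs0 r)
      linarith
    · let G : (Fin n → N) → ℂ := fun t =>
        ∑ r, a 0 (t r) * ∑ y, star (a 0 y) * symFun (fun x => a x.succ) (Function.update t r y)
      have hG : ∀ t (σ : Equiv.Perm (Fin n)), G (t ∘ σ) = G t := by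
        intro t σ
        simp only [G]
        refine (Finset.sum_congr rfl fun r _ => ?_).trans (Equiv.sum_comp σ fun r => a 0 (t r) *
          ∑ y, star (a 0 y) * symFun (fun x => a x.succ) (Function.update t r y))
        congr 1
        refine Finset.sum_congr rfl fun y _ => ?_
        rw [← symFun_comp_perm _ (Function.update t (σ r) y) σ]
        congr 2
        ext x
        by_cases hx : x = r
        · simp [hx]
        · simp [hx]
      have h1 := sum_star_symFun_mul (fun x : Fin n => a x.succ) G hG
      have h2 : ∑ t, star (symFun (fun x : Fin n => a x.succ) t) * G t = ((∑ r, s r : ℝ) : ℂ) := by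
        simp only [G, Finset.mul_sum (s := (Finset.univ : Finset (Fin n)))]
        rw [Finset.sum_comm]
        push_cast
        exact Finset.sum_congr rfl fun r _ => hs r
      rw [h2] at h1
      have hfac : (n.factorial : ℂ) ≠ 0 := by exact_mod_cast n.factorial_ne_zero
      have h3 : ∑ t, star (prodFun (fun x : Fin n => a x.succ) t) * G t =
          (n.factorial : ℂ)⁻¹ * ((∑ r, s r : ℝ) : ℂ) := by
        rw [h1, ← mul_assoc, inv_mul_cancel₀ hfac, one_mul]
      have h4 := Equiv.sum_comp (Fin.consEquiv fun _ : Fin (n + 1) => N)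
        fun t => star (prodFun a t) * symFun a t
      have h5 : ∀ (y : N) (t : Fin n → N),
          prodFun a (Fin.cons y t : Fin (n + 1) → N) = a 0 y * prodFun (fun x => a x.succ) t := by
        intro y t
        simp [prodFun, Fin.prod_univ_succ]
      rw [← h4, Fintype.sum_prod_type]
      change ∑ y, ∑ t : Fin n → N, star (prodFun a (Fin.cons y t : Fin (n + 1) → N)) *
        symFun a (Fin.cons y t : Fin (n + 1) → N) = _
      simp only [symFun_cons, h5, mul_add, Finset.sum_add_distrib]
      push_cast at h3 ⊢
      rw [← h3, ← hqe]
      congr 1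
      · rw [Finset.sum_mul]
        refine Finset.sum_congr rfl fun y _ => ?_
        rw [Finset.mul_sum]
        refine Finset.sum_congr rfl fun t _ => ?_
        rw [star_mul', ← Complex.conj_mul', starRingEnd_apply]
        ring
      · rw [Finset.sum_comm]
        refine Finset.sum_congr rfl fun t _ => ?_
        simp only [G, Finset.mul_sum]
        rw [Finset.sum_comm]
        refine Finset.sum_congr rfl fun r _ => Finset.sum_congr rfl fun y _ => ?_
        rw [star_mul']
        ring

theorem factorial_mul_prod_le_sum_norm_sq_symFun [Fintype N] [DecidableEq N]
    (a : Fin n → N → ℂ) :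
    n.factorial * ∏ x, ∑ z, ‖a x z‖ ^ 2 ≤ ∑ t, ‖symFun a t‖ ^ 2 := by
  obtain ⟨q, hq, hqe⟩ := prod_norm_sq_le_inner_symFun a
  have h := sum_star_symFun_mul a (symFun a) (symFun_comp_perm a)
  rw [hqe] at h
  have h2 : ((∑ t, ‖symFun a t‖ ^ 2 : ℝ) : ℂ) = ((n.factorial * q : ℝ) : ℂ) := by
    push_cast
    rw [← h]
    exact Finset.sum_congr rfl fun t _ => (Complex.conj_mul' _).symm
  rw [Complex.ofReal_inj.mp h2]
  exact mul_le_mul_of_nonneg_left hq (by positivity)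

end SymmetricProduct

theorem factorial_mul_prod_le_sum_norm_sq_symProd {n d : ℕ} (A : Fin n → Op d) :
    n.factorial * ∏ t, ∑ i, ∑ j, ‖A t i j‖ ^ 2 ≤ ∑ i, ∑ j, ‖symProd A i j‖ ^ 2 := by
  have h := factorial_mul_prod_le_sum_norm_sq_symFun
    fun (t : Fin n) (p : Fin d × Fin d) => A t p.1 p.2
  simp only [Fintype.sum_prod_type] at h
  refine h.trans (le_of_eq ?_)
  rw [← Fintype.sum_prod_type', ← Equiv.sum_comp (Equiv.arrowProdEquivProdArrow _ _ _)]
  refine Finset.sum_congr rfl fun t _ => ?_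
  congr 2
  rw [symFun, symProd_apply, ← Equiv.sum_comp (Equiv.inv (Equiv.Perm (Fin n)))]
  refine Finset.sum_congr rfl fun σ _ => ?_
  rw [prodFun, ← Equiv.prod_comp σ]
  simp [Equiv.arrowProdEquivProdArrow]

/-! ### Fixed-point count and spectral comparison -/

/-- The number of pairs of a tuple and a permutation fixing it. -/
theorem sum_card_fixed_tuples (n d : ℕ) :
    ∑ σ : Equiv.Perm (Fin n), ∑ a : Fin n → Fin d, (if a ∘ σ = a then (1 : ℝ) else 0) =
      ∏ i ∈ Finset.range n, ((d : ℝ) + i) := by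
  induction n with
  | zero => simp
  | succ n ih =>
    rw [Finset.prod_range_succ, ← ih, ← Equiv.sum_comp (Equiv.Perm.decomposeFin (n := n)).symm,
      Fintype.sum_prod_type, Finset.sum_comm, Finset.sum_mul]
    refine Finset.sum_congr rfl fun e _ => ?_
    -- Index `0` is inserted into the cycles of `e`. For `p = 0` it forms a cycle of its own and `a
    -- 0` is free, giving `d`; each of the other `n` values of `p` forces `a 0`. Together they give
    -- the factor `d + n`.
    have h0 : ∀ (p : Fin (n + 1)) (a : Fin (n + 1) → Fin d),
        a ∘ Equiv.Perm.decomposeFin.symm (p, e) = a ↔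
          a p = a 0 ∧ (fun x : Fin n => a x.succ) ∘ e = fun x => a x.succ := by
      intro p a
      have hs : a p = a 0 → ∀ x, a (Equiv.swap 0 p x) = a x := by
        intro h x
        rcases eq_or_ne x 0 with rfl | h0
        · rw [Equiv.swap_apply_left, h]
        rcases eq_or_ne x p with rfl | hp
        · rw [Equiv.swap_apply_right, h]
        · rw [Equiv.swap_apply_of_ne_of_ne h0 hp]
      constructor
      · intro h
        have h1 : a p = a 0 := by simpa using congrFun h 0
        refine ⟨h1, funext fun x => ?_⟩
        have := congrFun h x.succ
        simpa [Equiv.Perm.decomposeFin_symm_apply_succ, hs h1] using this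
      · rintro ⟨h1, h2⟩
        funext x
        refine Fin.cases ?_ (fun x => ?_) x
        · simpa using h1
        · have := congrFun h2 x
          simpa [Equiv.Perm.decomposeFin_symm_apply_succ, hs h1] using this
    have h1 : ∀ p : Fin (n + 1), ∑ a : Fin (n + 1) → Fin d,
        (if a ∘ Equiv.Perm.decomposeFin.symm (p, e) = a then (1 : ℝ) else 0) =
        ∑ t : Fin n → Fin d, ∑ y : Fin d,
          (if (Fin.cons y t : Fin (n + 1) → Fin d) p = y then 1 else 0) *
            (if t ∘ e = t then 1 else 0) := by
      intro p
      rw [← Equiv.sum_comp (Fin.consEquiv fun _ : Fin (n + 1) => Fin d), Fintype.sum_prod_type,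
        Finset.sum_comm]
      refine Finset.sum_congr rfl fun t _ => Finset.sum_congr rfl fun y _ => ?_
      simp only [h0]
      simp only [Fin.consEquiv, Equiv.coe_fn_mk, Fin.cons_zero, Fin.cons_succ]
      by_cases h1 : (Fin.cons y t : Fin (n + 1) → Fin d) p = y <;> by_cases h2 : t ∘ e = t <;>
        simp [h1, h2]
    simp only [h1]
    rw [Fin.sum_univ_succ]
    simp only [Fin.cons_zero, Fin.cons_succ, ← Finset.sum_mul]
    simp only [Finset.sum_ite_eq, Finset.mem_univ, if_true, Finset.sum_const, Finset.card_univ,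
      Fintype.card_fin, nsmul_eq_mul, mul_one, one_mul, ← Finset.mul_sum]
    ring

/-- Eigenvalues of a matrix are bounded by the largest absolute row sum. -/
theorem eigenvalue_le_of_row_sum_le {ι : Type*} [Fintype ι] {N : Matrix ι ι ℂ} {c : ℝ}
    (hN : ∀ i, ∑ j, ‖N i j‖ ≤ c) {v : ι → ℂ} (hv : v ≠ 0) {l : ℝ} (h : N *ᵥ v = l • v) :
    l ≤ c := by
  obtain ⟨i₀, hi₀⟩ := Function.ne_iff.mp hv
  obtain ⟨i, -, hi⟩ := Finset.exists_max_image Finset.univ (fun i => ‖v i‖) ⟨i₀, Finset.mem_univ _⟩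
  have hpos : 0 < ‖v i‖ := (norm_pos_iff.mpr hi₀).trans_le (hi i₀ (Finset.mem_univ _))
  have h1 : l * ‖v i‖ ≤ c * ‖v i‖ := by
    calc l * ‖v i‖ ≤ |l| * ‖v i‖ := mul_le_mul_of_nonneg_right (le_abs_self l) hpos.le
      _ = ‖(l • v) i‖ := by simp
      _ = ‖∑ j, N i j * v j‖ := by rw [← h]; rfl
      _ ≤ ∑ j, ‖N i j‖ * ‖v j‖ := (norm_sum_le _ _).trans (by simp)
      _ ≤ ∑ j, ‖N i j‖ * ‖v i‖ := Finset.sum_le_sum fun j _ =>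
          mul_le_mul_of_nonneg_left (hi j (Finset.mem_univ _)) (norm_nonneg _)
      _ ≤ c * ‖v i‖ := by
          rw [← Finset.sum_mul]; exact mul_le_mul_of_nonneg_right (hN i) hpos.le
  exact le_of_mul_le_mul_right h1 hpos

section MomentForm

variable {n d m : ℕ} {w : Fin m → ℝ} {U : Fin m → Op d}

theorem momentForm_sum_smul {ι : Type*} (s : Finset ι) (a b : ι → ℂ)
    (Y X : ι → Matrix (Fin n → Fin d) (Fin n → Fin d) ℂ) :
    momentForm w U (∑ i ∈ s, a i • Y i) (∑ j ∈ s, b j • X j) =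
      ∑ i ∈ s, ∑ j ∈ s, a i * star (b j) * momentForm w U (Y i) (X j) := by
  simp only [momentForm, Matrix.trace_sum, Matrix.mul_smul, Matrix.trace_smul,
    smul_eq_mul, star_sum, star_mul', Finset.mul_sum, Finset.sum_mul]
  rw [Finset.sum_comm]
  rw [Finset.sum_comm (s := s) (t := s)]
  refine Finset.sum_congr rfl fun j _ => ?_
  rw [Finset.sum_comm]
  refine Finset.sum_congr rfl fun i _ => Finset.sum_congr rfl fun k _ => ?_
  ring

theorem momentForm_self (X : Matrix (Fin n → Fin d) (Fin n → Fin d) ℂ) :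
    momentForm w U X X =
      ((∑ k, w k * ‖((tensorProd fun _ => U k) * X).trace‖ ^ 2 : ℝ) : ℂ) := by
  rw [momentForm]
  push_cast
  refine Finset.sum_congr rfl fun k _ => ?_
  rw [mul_assoc, ← Complex.mul_conj', starRingEnd_apply]

/-- `N` is self-adjoint both as a matrix and for the form, so its eigenspaces are orthogonal for the
form as well. The difference of the two sides is then the form at `∑ √(c - l i) Z i`, where `Z i`
are the spectral components of `X`. -/
theorem re_momentForm_mul_le (hw : ∀ k, 0 ≤ w k)
    {N : Matrix (Fin n → Fin d) (Fin n → Fin d) ℂ} (hN : N.IsHermitian)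
    (hNa : N ∈ adjointable w U) {c : ℝ} (hc : ∀ i, ∑ j, ‖N i j‖ ≤ c)
    (X : Matrix (Fin n → Fin d) (Fin n → Fin d) ℂ) :
    (momentForm w U (N * X) X).re ≤ c * (momentForm w U X X).re := by
  let l := hN.eigenvalues
  let v : (Fin n → Fin d) → (Fin n → Fin d) → ℂ := fun i => hN.eigenvectorBasis i
  have hv : ∀ i, N *ᵥ v i = l i • v i := hN.mulVec_eigenvectorBasis
  have hv0 : ∀ i, v i ≠ 0 := fun i h => hN.eigenvectorBasis.orthonormal.ne_zero i (by
    ext x; exact congrFun h x)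
  have hl : ∀ i, l i ≤ c := fun i => eigenvalue_le_of_row_sum_le hc (hv0 i) (hv i)
  let P : (Fin n → Fin d) → Matrix (Fin n → Fin d) (Fin n → Fin d) ℂ := fun i =>
    vecMulVec (v i) (star (v i))
  have hP : ∑ i, P i = 1 := by
    have h := Matrix.mem_unitaryGroup_iff.mp hN.eigenvectorUnitary.2
    rw [← h]
    ext x y
    simp [P, v, Matrix.sum_apply, Matrix.mul_apply, vecMulVec_apply,
      Matrix.star_apply]
  have hNP : ∀ i, N * P i = (l i : ℂ) • P i := by
    intro i
    simp only [P]
    rw [mul_vecMulVec, hv]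
    ext x y
    simp [vecMulVec_apply, mul_assoc]
  let Z : (Fin n → Fin d) → Matrix (Fin n → Fin d) (Fin n → Fin d) ℂ := fun i => P i * X
  have hZ : X = ∑ i, (1 : ℂ) • Z i := by
    simp only [Z, one_smul, ← Finset.sum_mul, hP, Matrix.one_mul]
  have hNZ : ∀ i, N * Z i = (l i : ℂ) • Z i := by
    intro i
    simp only [Z]
    rw [← Matrix.mul_assoc, hNP, Matrix.smul_mul]
  have hNX : N * X = ∑ i, (l i : ℂ) • Z i := by
    conv_lhs => rw [hZ]
    simp only [one_smul, Finset.mul_sum, hNZ]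
  have horth : ∀ i j, l i ≠ l j → momentForm w U (Z i) (Z j) = 0 := by
    intro i j hij
    have h := hNa (Z i) (Z j)
    rw [hN.eq, hNZ, hNZ] at h
    have h1 := momentForm_sum_smul (w := w) (U := U) {()} (fun _ => (l i : ℂ)) (fun _ => 1)
      (fun _ => Z i) (fun _ => Z j)
    have h2 := momentForm_sum_smul (w := w) (U := U) {()} (fun _ => 1) (fun _ => (l j : ℂ))
      (fun _ => Z i) (fun _ => Z j)
    simp only [Finset.sum_singleton, one_smul, star_one, mul_one, one_mul] at h1 h2
    rw [h1, h2] at h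
    have h3 : star (l j : ℂ) = l j := Complex.conj_ofReal _
    rw [h3] at h
    have h4 : ((l i : ℂ) - l j) * momentForm w U (Z i) (Z j) = 0 := by
      rw [sub_mul, h, sub_self]
    refine (mul_eq_zero.mp h4).resolve_left fun h5 => hij ?_
    exact_mod_cast sub_eq_zero.mp h5
  have hmain : (c : ℂ) * momentForm w U X X - momentForm w U (N * X) X =
      momentForm w U (∑ i, (Real.sqrt (c - l i) : ℂ) • Z i)
        (∑ i, (Real.sqrt (c - l i) : ℂ) • Z i) := by
    rw [hNX]
    nth_rewrite 1 [hZ]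
    rw [hZ, momentForm_sum_smul, momentForm_sum_smul, momentForm_sum_smul, Finset.mul_sum,
      ← Finset.sum_sub_distrib]
    refine Finset.sum_congr rfl fun i _ => ?_
    rw [Finset.mul_sum, ← Finset.sum_sub_distrib]
    refine Finset.sum_congr rfl fun j _ => ?_
    -- Components with equal eigenvalues need not be orthogonal, but for them the two square roots
    -- multiply to `c - l i`.
    by_cases hij : l i = l j
    · have h3 : star ((Real.sqrt (c - l j) : ℝ) : ℂ) = ((Real.sqrt (c - l j) : ℝ) : ℂ) :=
        Complex.conj_ofReal _
      have h4 : ((Real.sqrt (c - l j) : ℝ) : ℂ) * ((Real.sqrt (c - l j) : ℝ) : ℂ) = c - l j := by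
        rw [← Complex.ofReal_mul, Real.mul_self_sqrt (by linarith [hl j])]
        push_cast; rfl
      rw [h3, hij, h4]
      simp only [star_one]
      ring
    · rw [horth i j hij]; ring
  have hre := congrArg Complex.re hmain
  rw [Complex.sub_re, Complex.re_ofReal_mul] at hre
  have hnn : 0 ≤ (momentForm w U (∑ i, (Real.sqrt (c - l i) : ℂ) • Z i)
      (∑ i, (Real.sqrt (c - l i) : ℂ) • Z i)).re := by
    rw [momentForm_self, Complex.ofReal_re]
    exact Finset.sum_nonneg fun k _ => mul_nonneg (hw k) (by positivity)
  linarith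

end MomentForm

/-! ### The Casimir operator and the moment bound -/

/-- Symmetrized products of matrix units. -/
def symUnit {n d : ℕ} (a b : Fin n → Fin d) : Matrix (Fin n → Fin d) (Fin n → Fin d) ℂ :=
  symProd fun t => Matrix.single (a t) (b t) 1

theorem symUnit_apply {n d : ℕ} (a b i j : Fin n → Fin d) :
    symUnit a b i j = ∑ σ : Equiv.Perm (Fin n),
      (((if a ∘ σ = i then 1 else 0) * (if b ∘ σ = j then 1 else 0) : ℝ) : ℂ) := by
  rw [symUnit, symProd_apply]
  refine Finset.sum_congr rfl fun σ _ => ?_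
  by_cases h1 : a ∘ σ = i
  · by_cases h2 : b ∘ σ = j
    · subst h1 h2; simp
    · obtain ⟨t, ht⟩ := Function.ne_iff.mp h2
      rw [Finset.prod_eq_zero (Finset.mem_univ t)]
      · simp [h2]
      · exact Matrix.single_apply_of_ne _ _ _ _ _ (fun h => ht h.2)
  · obtain ⟨t, ht⟩ := Function.ne_iff.mp h1
    rw [Finset.prod_eq_zero (Finset.mem_univ t)]
    · simp [h1]
    · exact Matrix.single_apply_of_ne _ _ _ _ _ (fun h => ht h.1)

theorem conjTranspose_symUnit {n d : ℕ} (a b : Fin n → Fin d) : (symUnit a b)ᴴ = symUnit b a := by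
  ext i j
  rw [Matrix.conjTranspose_apply, symUnit_apply, symUnit_apply, star_sum]
  refine Finset.sum_congr rfl fun σ _ => ?_
  rw [mul_comm]
  exact Complex.conj_ofReal _

/-- The sum of the squares of all symmetrized products of matrix units. -/
def symCasimir (n d : ℕ) : Matrix (Fin n → Fin d) (Fin n → Fin d) ℂ :=
  ∑ a, ∑ b, (symUnit a b)ᴴ * symUnit a b

theorem isHermitian_symCasimir (n d : ℕ) : (symCasimir n d).IsHermitian := by
  simp [Matrix.IsHermitian, symCasimir, Matrix.conjTranspose_sum, Matrix.conjTranspose_mul]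

theorem sum_ite_comp_perm_eq {n d : ℕ} (σ : Equiv.Perm (Fin n)) (i : Fin n → Fin d) :
    ∑ b : Fin n → Fin d, (if b ∘ σ = i then (1 : ℝ) else 0) = 1 := by
  have h : ∀ b : Fin n → Fin d, b ∘ σ = i ↔ i ∘ σ.symm = b := by
    intro b
    constructor
    · rintro rfl; ext x; simp
    · rintro rfl; ext x; simp
  simp [h]

theorem sum_ite_perm_comp_eq {n d : ℕ} (σ : Equiv.Perm (Fin n)) :
    ∑ τ : Equiv.Perm (Fin n), ∑ a : Fin n → Fin d, (if a ∘ τ = a ∘ σ then (1 : ℝ) else 0) =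
      ∏ i ∈ Finset.range n, ((d : ℝ) + i) := by
  rw [← sum_card_fixed_tuples, ← Equiv.sum_comp (Equiv.mulRight σ)]
  refine Finset.sum_congr rfl fun τ _ => Finset.sum_congr rfl fun a _ => ?_
  have : a ∘ (Equiv.mulRight σ τ) = a ∘ σ ↔ a ∘ τ = a := by
    constructor
    · intro h
      ext x
      have := congrFun h (σ.symm x)
      simp at this
      simp [this]
    · intro h
      ext x
      have := congrFun h (σ x)
      simp at this
      simp [this]
  simp only [this]

/-- After bounding entries by sums of nonnegative indicators, summing over `j` and `b` leaves the
number of triples `(σ, τ, a)` with `a ∘ τ = a ∘ σ`, which is `n!` times the fixed-tuple count. -/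
theorem sum_norm_symCasimir_le {n d : ℕ} (i : Fin n → Fin d) :
    ∑ j, ‖symCasimir n d i j‖ ≤ n.factorial * ∏ k ∈ Finset.range n, ((d : ℝ) + k) := by
  have h1 : ∀ a b i j : Fin n → Fin d, ‖symUnit a b i j‖ ≤ ∑ σ : Equiv.Perm (Fin n),
      (if a ∘ σ = i then (1 : ℝ) else 0) * (if b ∘ σ = j then 1 else 0) := by
    intro a b i j
    rw [symUnit_apply]
    refine (norm_sum_le _ _).trans (Finset.sum_le_sum fun σ _ => ?_)
    rw [Complex.norm_real, Real.norm_of_nonneg]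
    split_ifs <;> norm_num
  have h2 : ∀ j, ‖symCasimir n d i j‖ ≤ ∑ a : Fin n → Fin d, ∑ b : Fin n → Fin d, ∑ l : Fin n → Fin d,
      (∑ σ : Equiv.Perm (Fin n), (if a ∘ σ = l then (1 : ℝ) else 0) * (if b ∘ σ = i then 1 else 0)) *
      (∑ σ : Equiv.Perm (Fin n), (if a ∘ σ = l then (1 : ℝ) else 0) * (if b ∘ σ = j then 1 else 0)) := by
    intro j
    simp only [symCasimir, Matrix.sum_apply, Matrix.mul_apply, Matrix.conjTranspose_apply]
    refine (norm_sum_le _ _).trans (Finset.sum_le_sum fun a _ => ?_)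
    refine (norm_sum_le _ _).trans (Finset.sum_le_sum fun b _ => ?_)
    refine (norm_sum_le _ _).trans (Finset.sum_le_sum fun l _ => ?_)
    rw [norm_mul, norm_star]
    exact mul_le_mul (h1 _ _ _ _) (h1 _ _ _ _) (norm_nonneg _)
      (Finset.sum_nonneg fun σ _ => by split_ifs <;> norm_num)
  refine (Finset.sum_le_sum fun j _ => h2 j).trans (le_of_eq ?_)
  calc ∑ j : Fin n → Fin d, ∑ a : Fin n → Fin d, ∑ b : Fin n → Fin d, ∑ l : Fin n → Fin d,
      (∑ σ : Equiv.Perm (Fin n), (if a ∘ σ = l then (1 : ℝ) else 0) * (if b ∘ σ = i then 1 else 0)) *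
      (∑ σ : Equiv.Perm (Fin n), (if a ∘ σ = l then (1 : ℝ) else 0) * (if b ∘ σ = j then 1 else 0))
      = ∑ a : Fin n → Fin d, ∑ b : Fin n → Fin d, ∑ l : Fin n → Fin d,
      (∑ σ : Equiv.Perm (Fin n), (if a ∘ σ = l then (1 : ℝ) else 0) * (if b ∘ σ = i then 1 else 0)) *
      (∑ σ : Equiv.Perm (Fin n), (if a ∘ σ = l then (1 : ℝ) else 0)) := by
        rw [Finset.sum_comm]
        refine Finset.sum_congr rfl fun a _ => ?_
        rw [Finset.sum_comm]
        refine Finset.sum_congr rfl fun b _ => ?_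
        rw [Finset.sum_comm]
        refine Finset.sum_congr rfl fun l _ => ?_
        rw [← Finset.mul_sum]
        congr 1
        rw [Finset.sum_comm]
        refine Finset.sum_congr rfl fun σ _ => ?_
        rw [← Finset.mul_sum]
        simp
    _ = ∑ a : Fin n → Fin d, ∑ l, (∑ σ : Equiv.Perm (Fin n), (if a ∘ σ = l then (1 : ℝ) else 0)) *
      (∑ σ : Equiv.Perm (Fin n), (if a ∘ σ = l then (1 : ℝ) else 0)) := by
        refine Finset.sum_congr rfl fun a _ => ?_
        rw [Finset.sum_comm]
        refine Finset.sum_congr rfl fun l _ => ?_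
        rw [← Finset.sum_mul]
        congr 1
        rw [Finset.sum_comm]
        refine Finset.sum_congr rfl fun σ _ => ?_
        rw [← Finset.mul_sum, sum_ite_comp_perm_eq, mul_one]
    _ = ∑ σ : Equiv.Perm (Fin n), ∑ τ : Equiv.Perm (Fin n), ∑ a : Fin n → Fin d,
      (if a ∘ τ = a ∘ σ then (1 : ℝ) else 0) := by
        simp only [Finset.sum_mul_sum]
        simp only [Finset.sum_comm (s := (Finset.univ : Finset (Equiv.Perm (Fin n))))
          (t := (Finset.univ : Finset (Fin n → Fin d)))]
        refine Finset.sum_congr rfl fun a _ => ?_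
        rw [Finset.sum_comm]
        refine Finset.sum_congr rfl fun σ _ => ?_
        rw [Finset.sum_comm]
        refine Finset.sum_congr rfl fun τ _ => ?_
        simp [eq_comm (a := a ∘ σ)]
    _ = _ := by
        simp only [sum_ite_perm_comp_eq, Finset.sum_const, Finset.card_univ, Fintype.card_perm,
          Fintype.card_fin, nsmul_eq_mul]

/-- Since `tr (U E_ab A) = (A U)_ba`, multiplying by symmetrized matrix units and tracing reads off
the entries of the symmetrized product. -/
theorem trace_tensorProd_mul_symUnit_mul {n d : ℕ} (U : Op d) (A : Fin n → Op d)
    (a b : Fin n → Fin d) :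
    ((tensorProd fun _ => U) * (symUnit a b * tensorProd A)).trace =
      symProd (fun t => A t * U) b a := by
  rw [symUnit, symProd, Finset.sum_mul, Finset.mul_sum, Matrix.trace_sum, symProd_apply,
    ← Equiv.sum_comp (Equiv.inv (Equiv.Perm (Fin n)))]
  refine Finset.sum_congr rfl fun σ _ => ?_
  rw [tensorProd_mul, tensorProd_mul, trace_tensorProd, ← Equiv.prod_comp σ]
  refine Finset.prod_congr rfl fun t _ => ?_
  have h : (Equiv.inv (Equiv.Perm (Fin n)) σ) (σ t) = t := by simp
  rw [h]
  rw [Matrix.trace_mul_comm, Matrix.mul_assoc, Matrix.trace_single_mul]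
  simp

theorem sum_norm_sq_mul_unitary {d : ℕ} {U : Op d} (hU : U ∈ Matrix.unitaryGroup (Fin d) ℂ)
    (A : Op d) : ∑ i, ∑ j, ‖(A * U) i j‖ ^ 2 = ∑ i, ∑ j, ‖A i j‖ ^ 2 := by
  have h : ∀ B : Op d, ((∑ i, ∑ j, ‖B i j‖ ^ 2 : ℝ) : ℂ) = (B * Bᴴ).trace := by
    intro B
    simp only [Matrix.trace, Matrix.diag, Matrix.mul_apply, Matrix.conjTranspose_apply]
    push_cast
    refine Finset.sum_congr rfl fun i _ => Finset.sum_congr rfl fun j _ => ?_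
    rw [← Complex.mul_conj', starRingEnd_apply]
  have h1 : U * Uᴴ = 1 := Matrix.mem_unitaryGroup_iff.mp hU
  apply Complex.ofReal_injective
  rw [h, h, Matrix.conjTranspose_mul, Matrix.mul_assoc, ← Matrix.mul_assoc U, h1, Matrix.one_mul]

/-- There is a finitely supported distribution on the unitary group for which the average of
`∏ t, |tr (U * A t)|²` is at least `∏ t, ‖A t‖² / (d + t)`, with Frobenius norms. -/
theorem exists_unitary_design (n d : ℕ) :
    ∃ (m : ℕ) (w : Fin m → ℝ) (U : Fin m → Op d), (∀ k, 0 ≤ w k) ∧ ∑ k, w k = 1 ∧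
      (∀ k, U k ∈ Matrix.unitaryGroup (Fin d) ℂ) ∧ ∀ A : Fin n → Op d,
        ∏ t, ∑ i, ∑ j, ‖A t i j‖ ^ 2 ≤ (∏ k ∈ Finset.range n, ((d : ℝ) + k)) *
          ∑ k, w k * ∏ t, ‖(U k * A t).trace‖ ^ 2 := by
  obtain ⟨m, w, U, hw, hw1, hU, hinv⟩ := exists_invariant_design n d
  refine ⟨m, w, U, hw, hw1, hU, fun A => ?_⟩
  have hS : ∀ a b : Fin n → Fin d, symUnit a b ∈ adjointable w U := fun a b =>
    symProd_mem _ (fun _ h _ h' => mul_mem_adjointable h h') (fun V hV => hinv V hV) _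
  have hC : symCasimir n d ∈ adjointable w U := Submodule.sum_mem _ fun a _ =>
    Submodule.sum_mem _ fun b _ => by
      rw [conjTranspose_symUnit]
      exact mul_mem_adjointable (hS b a) (hS a b)
  have h1 := re_momentForm_mul_le hw (isHermitian_symCasimir n d) hC
    (fun i => sum_norm_symCasimir_le i) (tensorProd A)
  have h2 : momentForm w U (symCasimir n d * tensorProd A) (tensorProd A) =
      ∑ a, ∑ b, momentForm w U (symUnit a b * tensorProd A) (symUnit a b * tensorProd A) := by
    have h3 : ∀ a b, momentForm w U (symUnit a b * tensorProd A) (symUnit a b * tensorProd A) =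
        momentForm w U ((symUnit a b)ᴴ * symUnit a b * tensorProd A) (tensorProd A) := by
      intro a b
      rw [Matrix.mul_assoc, conjTranspose_symUnit, hS b a, conjTranspose_symUnit]
    simp only [h3]
    simp only [momentForm, symCasimir, Finset.sum_mul, Finset.mul_sum, Matrix.trace_sum]
    rw [Finset.sum_comm]
    refine Finset.sum_congr rfl fun a _ => ?_
    rw [Finset.sum_comm]
  have h4 : (momentForm w U (symCasimir n d * tensorProd A) (tensorProd A)).re =
      ∑ k, w k * ∑ a, ∑ b, ‖symProd (fun t => A t * U k) b a‖ ^ 2 := by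
    rw [h2]
    simp only [momentForm_self, trace_tensorProd_mul_symUnit_mul]
    simp only [← Complex.ofReal_sum, Complex.ofReal_re, Finset.mul_sum]
    rw [Finset.sum_comm]
    simp only [Finset.sum_comm (t := (Finset.univ : Finset (Fin m)))]
    exact Finset.sum_congr rfl fun k _ => Finset.sum_comm
  -- The permanent inequality is applied to the operators `A t * U k`; right multiplication by a
  -- unitary preserves Frobenius norms.
  have h5 : n.factorial * ∏ t, ∑ i, ∑ j, ‖A t i j‖ ^ 2 ≤
      (momentForm w U (symCasimir n d * tensorProd A) (tensorProd A)).re := by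
    rw [h4]
    calc (n.factorial : ℝ) * ∏ t, ∑ i, ∑ j, ‖A t i j‖ ^ 2
        = ∑ k, w k * (n.factorial * ∏ t, ∑ i, ∑ j, ‖A t i j‖ ^ 2) := by
          rw [← Finset.sum_mul, hw1, one_mul]
      _ ≤ _ := by
          refine Finset.sum_le_sum fun k _ => mul_le_mul_of_nonneg_left ?_ (hw k)
          have h := factorial_mul_prod_le_sum_norm_sq_symProd fun t => A t * U k
          simp only [sum_norm_sq_mul_unitary (hU k)] at h
          rw [Finset.sum_comm]
          exact h
  have h6 : (momentForm w U (tensorProd A) (tensorProd A)).re =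
      ∑ k, w k * ∏ t, ‖(U k * A t).trace‖ ^ 2 := by
    rw [momentForm_self, Complex.ofReal_re]
    simp only [tensorProd_mul, trace_tensorProd, norm_prod, Finset.prod_pow]
  have hfac : (0 : ℝ) < n.factorial := by exact_mod_cast n.factorial_pos
  have h7 := h5.trans h1
  rw [h6, mul_assoc] at h7
  exact le_of_mul_le_mul_left h7 hfac

/-! ### Kraus maps, outcome probabilities and output laws -/

/-- The map `ρ ↦ K * ρ * Kᴴ`. -/
def conjMap {d : ℕ} (K : Op d) : Op d →ₗ[ℂ] Op d :=
  LinearMap.mulLeft ℂ K ∘ₗ LinearMap.mulRight ℂ Kᴴ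

theorem conjMap_apply {d : ℕ} (K ρ : Op d) : conjMap K ρ = K * ρ * Kᴴ := by
  simp [conjMap, Matrix.mul_assoc]

/-- The map `ρ ↦ ∑ i, c i • (K i * ρ * (K i)ᴴ)`. -/
def krausMap {d : ℕ} {κ : Type*} [Fintype κ] (c : κ → ℝ) (K : κ → Op d) : Op d →ₗ[ℂ] Op d :=
  ∑ i, (c i : ℂ) • conjMap (K i)

theorem krausMap_apply {d : ℕ} {κ : Type*} [Fintype κ] (c : κ → ℝ) (K : κ → Op d) (ρ : Op d) :
    krausMap c K ρ = ∑ i, (c i : ℂ) • (K i * ρ * (K i)ᴴ) := by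
  simp [krausMap, conjMap_apply]

theorem isChannel_krausMap {d : ℕ} {κ : Type*} [Fintype κ] {c : κ → ℝ} {K : κ → Op d}
    (hc : ∀ i, 0 ≤ c i) (hK : ∑ i, (c i : ℂ) • ((K i)ᴴ * K i) = 1) : IsChannel (krausMap c K) := by
  classical
  let e := Fintype.equivFin κ
  have hs : ∀ i, ((Real.sqrt (c i) : ℝ) : ℂ) * ((Real.sqrt (c i) : ℝ) : ℂ) = c i := fun i => by
    rw [← Complex.ofReal_mul, Real.mul_self_sqrt (hc i)]
  refine ⟨Fintype.card κ, fun k => ((Real.sqrt (c (e.symm k)) : ℝ) : ℂ) • K (e.symm k),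
    fun ρ => ?_, ?_⟩
  · rw [krausMap_apply, ← Equiv.sum_comp e.symm]
    refine Finset.sum_congr rfl fun k _ => ?_
    rw [← hs]
    simp only [Matrix.conjTranspose_smul, Complex.star_def, Complex.conj_ofReal, Matrix.smul_mul,
      Matrix.mul_smul, smul_smul]
  · have h : ∑ k, ((((Real.sqrt (c (e.symm k)) : ℝ) : ℂ) • K (e.symm k))ᴴ *
        (((Real.sqrt (c (e.symm k)) : ℝ) : ℂ) • K (e.symm k))) = 1 := by
      rw [← hK, ← Equiv.sum_comp e.symm]
      refine Finset.sum_congr rfl fun k _ => ?_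
      rw [← hs]
      simp only [Matrix.conjTranspose_smul, Complex.star_def, Complex.conj_ofReal, Matrix.smul_mul,
      Matrix.mul_smul, smul_smul]
    rw [h, sub_self]
    exact Matrix.PosSemidef.zero

theorem isTracePreserving_krausMap {d : ℕ} {κ : Type*} [Fintype κ] {c : κ → ℝ} {K : κ → Op d}
    (hK : ∑ i, (c i : ℂ) • ((K i)ᴴ * K i) = 1) : IsTracePreserving (krausMap c K) := by
  intro ρ
  calc (krausMap c K ρ).trace = ((∑ i, (c i : ℂ) • ((K i)ᴴ * K i)) * ρ).trace := by
        rw [krausMap_apply, Finset.sum_mul, Matrix.trace_sum, Matrix.trace_sum]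
        refine Finset.sum_congr rfl fun i _ => ?_
        rw [Matrix.trace_smul, Matrix.smul_mul, Matrix.trace_smul, Matrix.trace_mul_comm,
          ← Matrix.mul_assoc]
    _ = ρ.trace := by rw [hK, Matrix.one_mul]

theorem trace_vecMulVec_mul_vecMulVec {ι : Type*} [Fintype ι] (a b : ι → ℂ) :
    (vecMulVec a (star a) * vecMulVec b (star b)).trace = (‖star a ⬝ᵥ b‖ : ℂ) ^ 2 := by
  rw [vecMulVec_mul_vecMulVec, Matrix.trace_vecMulVec, ← Complex.mul_conj', starRingEnd_apply,
    Matrix.star_dotProduct, star_star]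
  simp [dotProduct_comm, mul_comm]

section Prob

variable {d : ℕ}

theorem Experiment.prob_krausMap (e : Experiment d) {κ : Type*} [Fintype κ] (c : κ → ℝ)
    (K : κ → Op d) (v : Fin e.outcomes) :
    e.prob (krausMap c K) v = ∑ i, c i * e.prob (conjMap (K i)) v := by
  have h : applyMain (krausMap c K) e.state =
      ∑ i, (c i : ℂ) • applyMain (conjMap (K i)) e.state := by
    ext p q
    simp [applyMain, krausMap, Matrix.sum_apply]
  simp only [Experiment.prob, h, Finset.mul_sum, Matrix.trace_sum, Matrix.mul_smul,
    Matrix.trace_smul, Complex.re_sum, smul_eq_mul, Complex.re_ofReal_mul]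

/-- With one Kraus operator the outcome probabilities are sums of squared absolute values of
linear functionals of it. -/
theorem Experiment.exists_prob_conjMap_eq (e : Experiment d) (v : Fin e.outcomes) :
    ∃ (m : ℕ) (A : Fin m → Op d), ∀ K : Op d,
      e.prob (conjMap K) v = ∑ x, ‖(K * A x).trace‖ ^ 2 := by
  obtain ⟨m₁, ψ, hψ⟩ := Matrix.posSemidef_iff_eq_sum_vecMulVec.mp e.state_posSemidef
  obtain ⟨m₂, φ, hφ⟩ := Matrix.posSemidef_iff_eq_sum_vecMulVec.mp (e.povm_posSemidef v)
  -- `B` contracts the ancilla indices of a state vector `ψ` against a POVM vector `φ`, so that `⟨φ,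
  -- (K ⊗ 1) ψ⟩ = tr (K B)` and the ancilla disappears.
  let B : Fin m₁ × Fin m₂ → Op d := fun x =>
    Matrix.of fun i j => ∑ a, ψ x.1 (i, a) * star (φ x.2 (j, a))
  refine ⟨Fintype.card (Fin m₁ × Fin m₂),
    fun x => B ((Fintype.equivFin (Fin m₁ × Fin m₂)).symm x), fun K => ?_⟩
  rw [Equiv.sum_comp (Fintype.equivFin (Fin m₁ × Fin m₂)).symm fun x => ‖(K * B x).trace‖ ^ 2]
  let g : Fin m₁ → Fin d × Fin e.anc → ℂ := fun k q => ∑ i, K q.1 i * ψ k (i, q.2)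
  have hg : applyMain (conjMap K) e.state = ∑ k, vecMulVec (g k) (star (g k)) := by
    ext p q
    simp only [applyMain, Matrix.of_apply, conjMap_apply, hψ, Matrix.mul_apply, Matrix.sum_apply,
      vecMulVec_apply, Matrix.conjTranspose_apply, g, Pi.star_apply, star_sum, star_mul',
      Finset.mul_sum, Finset.sum_mul]
    rw [Finset.sum_comm]
    simp only [Finset.sum_comm (t := (Finset.univ : Finset (Fin m₁)))]
    refine Finset.sum_congr rfl fun k _ => ?_
    rw [Finset.sum_comm]
    refine Finset.sum_congr rfl fun i _ => Finset.sum_congr rfl fun j _ => ?_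
    ring
  have hB : ∀ k l, star (φ l) ⬝ᵥ g k = (K * B (k, l)).trace := by
    intro k l
    simp only [dotProduct, Fintype.sum_prod_type, g, Matrix.trace, Matrix.diag, Matrix.mul_apply, B,
      Matrix.of_apply, Finset.mul_sum, Pi.star_apply]
    refine Finset.sum_congr rfl fun j _ => ?_
    rw [Finset.sum_comm]
    refine Finset.sum_congr rfl fun i _ => Finset.sum_congr rfl fun a _ => ?_
    ring
  have htr : (e.povm v * applyMain (conjMap K) e.state).trace =
      ((∑ x, ‖(K * B x).trace‖ ^ 2 : ℝ) : ℂ) := by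
    rw [hg, hφ]
    simp only [Finset.sum_mul, Finset.mul_sum, Matrix.trace_sum, trace_vecMulVec_mul_vecMulVec, hB]
    push_cast
    rw [Fintype.sum_prod_type]
  rw [Experiment.prob, htr, Complex.ofReal_re]

theorem Experiment.prob_conjMap_nonneg (e : Experiment d) (K : Op d) (v : Fin e.outcomes) :
    0 ≤ e.prob (conjMap K) v := by
  obtain ⟨m, A, h⟩ := e.exists_prob_conjMap_eq v
  rw [h]
  positivity

theorem Experiment.prob_krausMap_nonneg (e : Experiment d) {κ : Type*} [Fintype κ] {c : κ → ℝ}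
    (hc : ∀ i, 0 ≤ c i) (K : κ → Op d) (v : Fin e.outcomes) : 0 ≤ e.prob (krausMap c K) v := by
  rw [e.prob_krausMap]
  exact Finset.sum_nonneg fun i _ => mul_nonneg (hc i) (e.prob_conjMap_nonneg _ _)

theorem Experiment.sum_prob (e : Experiment d) {E : Op d →ₗ[ℂ] Op d} (hE : IsTracePreserving E) :
    ∑ v, e.prob E v = 1 := by
  have h : (applyMain E e.state).trace = e.state.trace := by
    have h1 : ∀ ρ : BiOp d e.anc,
        ρ.trace = ∑ a, (Matrix.of fun i j => ρ (i, a) (j, a) : Op d).trace := by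
      intro ρ
      simp only [Matrix.trace, Matrix.diag, Matrix.of_apply, Fintype.sum_prod_type]
      rw [Finset.sum_comm]
    rw [h1, h1 e.state]
    refine Finset.sum_congr rfl fun a _ => ?_
    exact hE (Matrix.of fun i j => e.state (i, a) (j, a))
  simp only [Experiment.prob]
  rw [← Complex.re_sum, ← Matrix.trace_sum, ← Finset.sum_mul, e.povm_sum, Matrix.one_mul, h,
    e.state_trace, Complex.one_re]

theorem Strategy.outputProb_nonneg {E : Op d →ₗ[ℂ] Op d}
    (hE : ∀ (e : Experiment d) v, 0 ≤ e.prob E v) (S : Set ℝ) {T : ℕ} (s : Strategy d T) :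
    0 ≤ s.outputProb E S := by
  induction s with
  | leaf z => rw [Strategy.outputProb]; split_ifs <;> norm_num
  | node e next ih =>
    rw [Strategy.outputProb]
    exact Finset.sum_nonneg fun v _ => mul_nonneg (hE e v) (ih v)

theorem Strategy.outputProb_add_compl {E : Op d →ₗ[ℂ] Op d} (hE : IsTracePreserving E) (S : Set ℝ)
    {T : ℕ} (s : Strategy d T) : s.outputProb E S + s.outputProb E Sᶜ = 1 := by
  induction s with
  | leaf z =>
    rw [Strategy.outputProb, Strategy.outputProb]
    by_cases h : z ∈ S <;> simp [h]
  | node e next ih =>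
    rw [Strategy.outputProb, Strategy.outputProb, ← Finset.sum_add_distrib]
    simp only [← mul_add, ih, mul_one]
    exact e.sum_prob hE

theorem Strategy.outputProb_mono {E : Op d →ₗ[ℂ] Op d}
    (hE : ∀ (e : Experiment d) v, 0 ≤ e.prob E v) {S S' : Set ℝ} (hS : S ⊆ S') {T : ℕ}
    (s : Strategy d T) : s.outputProb E S ≤ s.outputProb E S' := by
  induction s with
  | leaf z =>
    rw [Strategy.outputProb, Strategy.outputProb]
    by_cases h : z ∈ S
    · simp [h, hS h]
    · rw [if_neg h]; split_ifs <;> norm_num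
  | node e next ih =>
    rw [Strategy.outputProb, Strategy.outputProb]
    exact Finset.sum_le_sum fun v _ => mul_le_mul_of_nonneg_left (ih v) (hE e v)

theorem Strategy.outputProb_le_one {E : Op d →ₗ[ℂ] Op d}
    (hE : ∀ (e : Experiment d) v, 0 ≤ e.prob E v) (hE' : IsTracePreserving E) (S : Set ℝ)
    {T : ℕ} (s : Strategy d T) : s.outputProb E S ≤ 1 := by
  linarith [s.outputProb_add_compl hE' S, s.outputProb_nonneg hE Sᶜ]

end Prob

section Algorithm

variable {d T : ℕ} (A : IncoherentAlgorithm d T) {E : Op d →ₗ[ℂ] Op d}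

theorem IncoherentAlgorithm.integrable_outputProb (hE : ∀ (e : Experiment d) v, 0 ≤ e.prob E v)
    (hC : IsChannel E) (hT : IsTracePreserving E) {S : Set ℝ} (hS : MeasurableSet S) :
    letI := A.measurableSpace
    Integrable (fun ω => (A.strategy ω).outputProb E S) A.law := by
  let := A.measurableSpace
  have := A.isProbability
  refine Integrable.of_bound (A.measurable_outputProb E hC S hS).aestronglyMeasurable 1
    (Filter.Eventually.of_forall fun ω => ?_)
  rw [Real.norm_of_nonneg ((A.strategy ω).outputProb_nonneg hE S)]
  exact (A.strategy ω).outputProb_le_one hE hT S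

theorem IncoherentAlgorithm.outputProb_add_compl (hE : ∀ (e : Experiment d) v, 0 ≤ e.prob E v)
    (hC : IsChannel E) (hT : IsTracePreserving E) {S : Set ℝ} (hS : MeasurableSet S) :
    A.outputProb E S + A.outputProb E Sᶜ = 1 := by
  let := A.measurableSpace
  have := A.isProbability
  rw [IncoherentAlgorithm.outputProb, IncoherentAlgorithm.outputProb,
    ← integral_add (A.integrable_outputProb hE hC hT hS) (A.integrable_outputProb hE hC hT hS.compl)]
  simp [Strategy.outputProb_add_compl hT]

theorem IncoherentAlgorithm.outputProb_mono (hE : ∀ (e : Experiment d) v, 0 ≤ e.prob E v)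
    (hC : IsChannel E) (hT : IsTracePreserving E) {S S' : Set ℝ} (hS : MeasurableSet S)
    (hS' : MeasurableSet S') (hSS : S ⊆ S') : A.outputProb E S ≤ A.outputProb E S' :=
  integral_mono (A.integrable_outputProb hE hC hT hS) (A.integrable_outputProb hE hC hT hS')
    fun ω => (A.strategy ω).outputProb_mono hE hSS

end Algorithm

/-! ### The test channels and their unitarities -/

/-- The mixture of the identity channel, with weight `q`, and the completely depolarizing
channel. -/
noncomputable def mixedChannel (d : ℕ) (q : ℝ) : Op d →ₗ[ℂ] Op d :=
  krausMap (κ := Option (Fin d × Fin d)) (fun x => x.elim q fun _ => (1 - q) / d)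
    fun x => x.elim 1 fun p => Matrix.single p.1 p.2 1

theorem mixedChannel_apply (d : ℕ) (q : ℝ) (ρ : Op d) :
    mixedChannel d q ρ = (q : ℂ) • ρ + (((1 - q) / d : ℝ) * ρ.trace : ℂ) • 1 := by
  rw [mixedChannel, krausMap_apply, Fintype.sum_option]
  simp only [Option.elim_none, Option.elim_some, Matrix.one_mul, Matrix.conjTranspose_one,
    Matrix.mul_one]
  congr 1
  rw [← Finset.smul_sum, mul_smul]
  congr 1
  ext i j
  simp only [Fintype.sum_prod_type, Matrix.sum_apply, Matrix.conjTranspose_single, star_one,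
    Matrix.mul_apply, Matrix.single_apply, Matrix.smul_apply, Matrix.one_apply, Matrix.trace,
    Matrix.diag, smul_eq_mul]
  by_cases hij : i = j
  · subst hij
    simp [ite_and]
  · simp [hij, Ne.symm hij, ite_and]

section Mixed

variable {d : ℕ} {q : ℝ}

theorem sum_kraus_mixedChannel (hd : d ≠ 0) :
    ∑ x : Option (Fin d × Fin d), ((x.elim q fun _ => (1 - q) / d : ℝ) : ℂ) •
      ((x.elim 1 fun p => Matrix.single p.1 p.2 1 : Op d)ᴴ *
        (x.elim 1 fun p => Matrix.single p.1 p.2 1 : Op d)) = 1 := by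
  have hd' : (d : ℂ) ≠ 0 := by exact_mod_cast hd
  rw [Fintype.sum_option]
  simp only [Option.elim_none, Option.elim_some, Matrix.conjTranspose_one, mul_one,
    Matrix.conjTranspose_single, star_one, Matrix.single_mul_single_same, ← Finset.smul_sum,
    Fintype.sum_prod_type]
  have h : ∑ _i : Fin d, ∑ j : Fin d, Matrix.single j j (1 : ℂ) = (d : ℂ) • (1 : Op d) := by
    rw [Finset.sum_const, Finset.card_univ, Fintype.card_fin, ← Nat.cast_smul_eq_nsmul ℂ]
    congr 1
    ext i j
    simp [Matrix.sum_apply, Matrix.single_apply, Matrix.one_apply, ite_and]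
  rw [h, smul_smul, ← add_smul]
  push_cast
  rw [div_mul_cancel₀ _ hd']
  simp

theorem isChannel_mixedChannel (hd : d ≠ 0) (h0 : 0 ≤ q) (h1 : q ≤ 1) :
    IsChannel (mixedChannel d q) := by
  refine isChannel_krausMap (fun x => ?_) (sum_kraus_mixedChannel hd)
  cases x with
  | none => exact h0
  | some p => exact div_nonneg (sub_nonneg.mpr h1) (Nat.cast_nonneg d)

theorem isTracePreserving_mixedChannel (hd : d ≠ 0) : IsTracePreserving (mixedChannel d q) :=
  isTracePreserving_krausMap (sum_kraus_mixedChannel hd)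

theorem Experiment.prob_mixedChannel_nonneg (h0 : 0 ≤ q) (h1 : q ≤ 1) (e : Experiment d)
    (v : Fin e.outcomes) : 0 ≤ e.prob (mixedChannel d q) v := by
  refine e.prob_krausMap_nonneg (fun x => ?_) _ v
  cases x with
  | none => exact h0
  | some p => exact div_nonneg (sub_nonneg.mpr h1) (Nat.cast_nonneg d)

theorem Experiment.prob_mixedChannel (e : Experiment d) (v : Fin e.outcomes) :
    e.prob (mixedChannel d q) v =
      q * e.prob (conjMap 1) v + (1 - q) * e.prob (mixedChannel d 0) v := by
  simp only [mixedChannel, e.prob_krausMap, Fintype.sum_option, Option.elim_none, Option.elim_some,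
    ← Finset.mul_sum]
  ring

/-- The Kraus operators of the depolarizing channel are the matrix units with weight `1/d`, and `tr
(E_ij A) = A_ji`, so the squared traces add up to the Frobenius norm. -/
theorem Experiment.prob_depolarizing (e : Experiment d) (v : Fin e.outcomes) {m : ℕ}
    {A : Fin m → Op d} (hA : ∀ K : Op d, e.prob (conjMap K) v = ∑ x, ‖(K * A x).trace‖ ^ 2) :
    e.prob (mixedChannel d 0) v = ∑ x, (∑ i, ∑ j, ‖A x i j‖ ^ 2) / d := by
  simp only [mixedChannel, e.prob_krausMap, Fintype.sum_option, Option.elim_none, Option.elim_some,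
    ← Finset.mul_sum, hA, Matrix.trace_single_mul, ← Finset.sum_div]
  rw [Finset.sum_comm]
  simp only [Fintype.sum_prod_type]
  have : ∀ x, ∑ i, ∑ j, ‖A x i j‖ ^ 2 = ∑ i, ∑ j, ‖A x j i‖ ^ 2 := fun x => Finset.sum_comm
  simp only [this, one_smul, zero_mul, zero_add, sub_zero, one_mul]
  ring

end Mixed

theorem unitarity_eq {d : ℕ} (E : Op d →ₗ[ℂ] Op d) :
    unitarity E = (∑ i, ∑ a, ∑ j, ∑ b, E (Matrix.single a b 1) i j *
      E (Matrix.single b a 1) j i).re / d ^ 2 := by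
  have h : ∀ p q : Fin d × Fin d,
      jamiolkowski E p q = (d : ℂ)⁻¹ * E (Matrix.single p.2 q.2 1) p.1 q.1 := by
    intro p q
    have h1 : (Matrix.of fun i j => Matrix.vecMulVec (maxEntangled d) (star (maxEntangled d))
        (i, p.2) (j, q.2) : Op d) = (d : ℂ)⁻¹ • Matrix.single p.2 q.2 1 := by
      ext i j
      have h2 : (((1 / Real.sqrt d : ℝ) : ℂ)) * (((1 / Real.sqrt d : ℝ) : ℂ)) = (d : ℂ)⁻¹ := by
        rw [← Complex.ofReal_mul, div_mul_div_comm, Real.mul_self_sqrt (Nat.cast_nonneg d)]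
        simp
      simp only [Matrix.of_apply, Matrix.vecMulVec_apply, maxEntangled, Pi.star_apply,
        Matrix.smul_apply, Matrix.single_apply, smul_eq_mul]
      by_cases hi : i = p.2
      · by_cases hj : j = q.2
        · subst hi hj
          rw [if_pos rfl, if_pos rfl, if_pos ⟨rfl, rfl⟩, Complex.star_def, Complex.conj_ofReal, h2,
            mul_one]
        · simp [hj, Ne.symm hj]
      · simp [hi, Ne.symm hi]
    rw [jamiolkowski, applyMain, Matrix.of_apply, h1, map_smul, Matrix.smul_apply, smul_eq_mul]
  rw [unitarity]
  simp only [Matrix.trace, Matrix.diag, Matrix.mul_apply, h, Fintype.sum_prod_type]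
  have h3 : ∀ x y : ℂ, (d : ℂ)⁻¹ * x * ((d : ℂ)⁻¹ * y) = (((d : ℝ) ^ 2)⁻¹ : ℝ) * (x * y) := by
    intro x y
    push_cast
    rw [sq, mul_inv]
    ring
  simp only [h3, ← Finset.mul_sum, Complex.re_ofReal_mul]
  rw [inv_mul_eq_div]

theorem unitarity_mixedChannel {d : ℕ} (hd : d ≠ 0) (q : ℝ) :
    unitarity (mixedChannel d q) = q ^ 2 + (1 - q ^ 2) / (d : ℝ) ^ 2 := by
  have hd' : (d : ℝ) ≠ 0 := by exact_mod_cast hd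
  have h : ∀ a b i j : Fin d, mixedChannel d q (Matrix.single a b 1) i j *
      mixedChannel d q (Matrix.single b a 1) j i =
      ((q ^ 2 * ((if a = i then 1 else 0) * (if b = j then 1 else 0)) +
        2 * q * ((1 - q) / d) * ((if a = i then 1 else 0) *
          ((if b = j then 1 else 0) * (if i = j then 1 else 0))) +
        ((1 - q) / d) ^ 2 * ((if a = b then 1 else 0) * (if i = j then 1 else 0)) : ℝ) : ℂ) := by
    intro a b i j
    simp only [mixedChannel_apply, Matrix.add_apply, Matrix.smul_apply, Matrix.single_apply,
      Matrix.one_apply, smul_eq_mul]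
    by_cases hab : a = b
    · subst hab
      by_cases hij : i = j
      · subst hij
        by_cases h : a = i
        · subst h; simp; ring
        · simp [h]; ring
      · by_cases h : a = i
        · subst h; simp [hij]
        · simp [h, hij, Ne.symm hij]
    · by_cases hij : i = j
      · subst hij
        by_cases h : a = i
        · subst h; simp [hab, Ne.symm hab]
        · simp [h, hab, Ne.symm hab]
      · by_cases h : a = i <;> by_cases h' : b = j <;>
          simp [hab, Ne.symm hab, hij, Ne.symm hij, h, h'] <;> ring
  rw [unitarity_eq]
  simp only [h, ← Complex.ofReal_sum, Complex.ofReal_re, Finset.sum_add_distrib]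
  have e1 : ∀ c : ℝ, ∑ i : Fin d, ∑ a : Fin d, ∑ j : Fin d, ∑ b : Fin d,
      c * ((if a = i then (1 : ℝ) else 0) * (if b = j then 1 else 0)) = c * d ^ 2 := by
    intro c
    simp
    ring
  have e2 : ∀ c : ℝ, ∑ i : Fin d, ∑ a : Fin d, ∑ j : Fin d, ∑ b : Fin d,
      c * ((if a = i then (1 : ℝ) else 0) * ((if b = j then 1 else 0) * (if i = j then 1 else 0))) =
        c * d := by
    intro c
    simp
    ring
  have e3 : ∀ c : ℝ, ∑ i : Fin d, ∑ a : Fin d, ∑ j : Fin d, ∑ b : Fin d,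
      c * ((if a = b then (1 : ℝ) else 0) * (if i = j then 1 else 0)) = c * d ^ 2 := by
    intro c
    simp
    ring
  rw [e1, e2, e3]
  field_simp
  ring

theorem sum_norm_sq_unitary {d : ℕ} {U : Op d} (hU : U ∈ Matrix.unitaryGroup (Fin d) ℂ) :
    ∑ i, ∑ j, ‖U i j‖ ^ 2 = d := by
  have h := sum_norm_sq_mul_unitary hU 1
  rw [Matrix.one_mul] at h
  rw [h]
  have h1 : ∀ i j : Fin d, ‖(1 : Op d) i j‖ ^ 2 = if i = j then (1 : ℝ) else 0 := by
    intro i j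
    rw [Matrix.one_apply]
    split_ifs <;> simp
  simp [h1]

section Unitary

variable {d : ℕ} {U : Op d}

theorem conjMap_eq_krausMap (U : Op d) :
    conjMap U = krausMap (κ := Unit) (fun _ => 1) fun _ => U := by
  simp [krausMap]

theorem isChannel_conjMap (hU : U ∈ Matrix.unitaryGroup (Fin d) ℂ) : IsChannel (conjMap U) := by
  rw [conjMap_eq_krausMap]
  have h : Uᴴ * U = 1 := Matrix.mem_unitaryGroup_iff'.mp hU
  exact isChannel_krausMap (fun _ => zero_le_one) (by simp [h])

theorem isTracePreserving_conjMap (hU : U ∈ Matrix.unitaryGroup (Fin d) ℂ) :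
    IsTracePreserving (conjMap U) := by
  rw [conjMap_eq_krausMap]
  have h : Uᴴ * U = 1 := Matrix.mem_unitaryGroup_iff'.mp hU
  exact isTracePreserving_krausMap (by simp [h])

theorem unitarity_conjMap (hd : d ≠ 0) (hU : U ∈ Matrix.unitaryGroup (Fin d) ℂ) :
    unitarity (conjMap U) = 1 := by
  have hd' : (d : ℝ) ≠ 0 := by exact_mod_cast hd
  have h1 : ∀ a b i j : Fin d, conjMap U (Matrix.single a b 1) i j = U i a * star (U j b) := by
    intro a b i j
    rw [conjMap_apply]
    simp [Matrix.mul_apply, Matrix.single_apply, ite_and]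
  have h : ∀ a b i j : Fin d, conjMap U (Matrix.single a b 1) i j *
      conjMap U (Matrix.single b a 1) j i = ((‖U i a‖ ^ 2 * ‖U j b‖ ^ 2 : ℝ) : ℂ) := by
    intro a b i j
    rw [h1, h1]
    push_cast
    rw [← Complex.mul_conj', ← Complex.mul_conj', starRingEnd_apply, starRingEnd_apply]
    ring
  rw [unitarity_eq]
  simp only [h, ← Complex.ofReal_sum, Complex.ofReal_re, ← Finset.mul_sum, ← Finset.sum_mul,
    sum_norm_sq_unitary hU]
  field_simp

end Unitary

/-! ### The bound of order `√d` -/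

/-- On average over a unitary design, no outcome is much less likely for the unitary channels than
for the completely depolarizing channel. -/
theorem Strategy.outputProb_depolarizing_le {d n m : ℕ} {w : Fin m → ℝ} {U : Fin m → Op d} {C : ℝ}
    (hd : d ≠ 0)
    (hU : ∀ A : Fin n → Op d, ∏ t, ∑ i, ∑ j, ‖A t i j‖ ^ 2 ≤
      C * ∑ k, w k * ∏ t, ‖(U k * A t).trace‖ ^ 2) (S : Set ℝ) {T : ℕ} (s : Strategy d T) :
    ∀ (l : ℕ) (A : Fin l → Op d), l + T = n →
      (∏ t, (∑ i, ∑ j, ‖A t i j‖ ^ 2) / d) * s.outputProb (mixedChannel d 0) S ≤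
        C / d ^ n * ∑ k, w k * ((∏ t, ‖(U k * A t).trace‖ ^ 2) *
          s.outputProb (conjMap (U k)) S) := by
  have hd' : (0 : ℝ) < d := by exact_mod_cast Nat.pos_of_ne_zero hd
  induction s with
  | leaf z =>
    intro l A hl
    obtain rfl : l = n := hl
    simp only [Strategy.outputProb]
    by_cases hz : z ∈ S
    · simp only [hz, if_true, mul_one, Finset.prod_div_distrib, Finset.prod_const, Finset.card_univ,
        Fintype.card_fin]
      rw [div_mul_eq_mul_div]
      exact div_le_div_of_nonneg_right (hU A) (by positivity)
    · simp [hz]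
  | node e next ih =>
    intro l A hl
    choose r B hB using e.exists_prob_conjMap_eq
    have key : ∀ v x, (∏ t, (∑ i, ∑ j, ‖A t i j‖ ^ 2) / d) *
        ((∑ i, ∑ j, ‖B v x i j‖ ^ 2) / d * (next v).outputProb (mixedChannel d 0) S) ≤
        C / d ^ n * ∑ k, w k * ((∏ t, ‖(U k * A t).trace‖ ^ 2) *
          (‖(U k * B v x).trace‖ ^ 2 * (next v).outputProb (conjMap (U k)) S)) := by
      intro v x
      -- `A` records the operators on the path so far. The moment bound is used only at the leaves,
      -- where the path has exactly `n` operators.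
      have h := ih v (l + 1) (Fin.cons (B v x) A) (by omega)
      simp only [Fin.prod_univ_succ, Fin.cons_zero, Fin.cons_succ] at h
      refine (le_of_eq ?_).trans (h.trans (le_of_eq ?_))
      · ring
      · congr 1
        exact Finset.sum_congr rfl fun k _ => by ring
    simp only [Strategy.outputProb]
    have h1 := Finset.sum_le_sum fun v (_ : v ∈ Finset.univ) =>
      Finset.sum_le_sum fun x (_ : x ∈ Finset.univ) => key v x
    refine (le_of_eq ?_).trans (h1.trans (le_of_eq ?_))
    · simp only [e.prob_depolarizing _ (hB _), Finset.mul_sum, Finset.sum_mul]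
    · simp only [hB, Finset.mul_sum, Finset.sum_mul]
      simp only [Finset.sum_comm (t := (Finset.univ : Finset (Fin m)))]

/-- By `1 + x ≤ exp x` the product is at most `exp (n² / (2d)) < exp (1/2) < 2`. -/
theorem prod_range_one_add_div_lt_two {d n : ℕ} (hd : d ≠ 0) (h : (n : ℝ) ^ 2 < d) :
    (∏ k ∈ Finset.range n, ((d : ℝ) + k)) / d ^ n < 2 := by
  have hd' : (0 : ℝ) < d := by exact_mod_cast Nat.pos_of_ne_zero hd
  have h1 : (∏ k ∈ Finset.range n, ((d : ℝ) + k)) / d ^ n =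
      ∏ k ∈ Finset.range n, (((d : ℝ) + k) / d) := by
    rw [Finset.prod_div_distrib, Finset.prod_const, Finset.card_range]
  have h2 : ∏ k ∈ Finset.range n, (((d : ℝ) + k) / d) ≤
      ∏ k ∈ Finset.range n, Real.exp ((k : ℝ) / d) := by
    refine Finset.prod_le_prod (fun k _ => by positivity) fun k _ => ?_
    rw [add_div, div_self hd'.ne', add_comm]
    exact Real.add_one_le_exp _
  have h3 : (∑ k ∈ Finset.range n, (k : ℝ)) ≤ (n : ℝ) ^ 2 / 2 := by
    have h4 := Finset.sum_range_id_mul_two n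
    have h5 : (∑ k ∈ Finset.range n, (k : ℝ)) * 2 ≤ (n : ℝ) ^ 2 := by
      have h6 : (∑ k ∈ Finset.range n, k) * 2 ≤ n ^ 2 := by
        rw [h4, sq]; exact Nat.mul_le_mul_left _ (Nat.sub_le _ _)
      have h7 := (Nat.cast_le (α := ℝ)).mpr h6
      push_cast at h7
      exact h7
    linarith
  rw [h1]
  refine h2.trans_lt ?_
  rw [← Real.exp_sum, ← Finset.sum_div, ← Real.lt_log_iff_exp_lt two_pos]
  have h4 : (∑ k ∈ Finset.range n, (k : ℝ)) / d < 1 / 2 := by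
    rw [div_lt_iff₀ hd']; linarith
  linarith [Real.log_two_gt_d9]

theorem measurableSet_abs_sub_le (u ε : ℝ) : MeasurableSet {z : ℝ | |z - u| ≤ ε} :=
  measurableSet_le (by fun_prop) measurable_const

section Bounds

variable {d T : ℕ} {ε : ℝ}

/-- If `T² < d`, an event of probability at least `2/3` for the depolarizing channel has probability
at most `1/3` for every unitary channel, so `2/3 ≤ C / 3` with `C < 2`, a contradiction. -/
theorem IncoherentAlgorithm.EstimatesUnitarity.sqrt_le (hd : 2 ≤ d)
    (hε : ε < (1 - 1 / (d : ℝ) ^ 2) / 2) (A : IncoherentAlgorithm d T)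
    (hA : A.EstimatesUnitarity ε) : Real.sqrt d ≤ T := by
  have hd0 : d ≠ 0 := by omega
  by_contra! hT
  have hT2 : (T : ℝ) ^ 2 < d := (Real.lt_sqrt (Nat.cast_nonneg T)).mp hT
  obtain ⟨m, w, U, hw, hw1, hU, hdes⟩ := exists_unitary_design T d
  let S := {z : ℝ | |z - 1 / (d : ℝ) ^ 2| ≤ ε}
  have hS : MeasurableSet S := measurableSet_abs_sub_le _ _
  set C := (∏ k ∈ Finset.range T, ((d : ℝ) + k)) / d ^ T with hC
  have hC2 : C < 2 := prod_range_one_add_div_lt_two hd0 hT2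
  have hC0 : 0 ≤ C := by positivity
  have hpos : ∀ k (e : Experiment d) v, 0 ≤ e.prob (conjMap (U k)) v :=
    fun k e v => e.prob_conjMap_nonneg _ v
  have hpos0 : ∀ (e : Experiment d) v, 0 ≤ e.prob (mixedChannel d 0) v :=
    fun e v => e.prob_mixedChannel_nonneg le_rfl zero_le_one v
  have hD : 2 / 3 ≤ A.outputProb (mixedChannel d 0) S := by
    have h := hA _ (isChannel_mixedChannel hd0 le_rfl zero_le_one)
      (isTracePreserving_mixedChannel hd0)
    rw [unitarity_mixedChannel hd0] at h
    simpa [S] using h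
  have hUk : ∀ k, A.outputProb (conjMap (U k)) S ≤ 1 / 3 := by
    intro k
    have hch := isChannel_conjMap (hU k)
    have htp := isTracePreserving_conjMap (hU k)
    have h := hA _ hch htp
    rw [unitarity_conjMap hd0 (hU k)] at h
    have hm := A.outputProb_mono (hpos k) hch htp (measurableSet_abs_sub_le 1 ε) hS.compl (by
      intro z hz hz'
      have h1 : |z - 1| ≤ ε := hz
      have h2 : |z - 1 / (d : ℝ) ^ 2| ≤ ε := hz'
      rw [abs_le] at h1 h2
      linarith [h1.1, h2.2])
    have hc := A.outputProb_add_compl (hpos k) hch htp hS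
    linarith
  have hmain : A.outputProb (mixedChannel d 0) S ≤
      C * ∑ k, w k * A.outputProb (conjMap (U k)) S := by
    let := A.measurableSpace
    have hi : ∀ k, Integrable (fun ω => (A.strategy ω).outputProb (conjMap (U k)) S) A.law :=
      fun k => A.integrable_outputProb (hpos k) (isChannel_conjMap (hU k))
        (isTracePreserving_conjMap (hU k)) hS
    have hi0 := A.integrable_outputProb hpos0 (isChannel_mixedChannel hd0 le_rfl zero_le_one)
      (isTracePreserving_mixedChannel hd0) hS
    simp only [IncoherentAlgorithm.outputProb]
    simp only [← integral_const_mul]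
    rw [← integral_finsetSum _ fun k _ => (hi k).const_mul (w k), ← integral_const_mul]
    refine integral_mono hi0
      ((integrable_finsetSum _ fun k _ => (hi k).const_mul (w k)).const_mul C) fun ω => ?_
    have h := (A.strategy ω).outputProb_depolarizing_le hd0 hdes S 0 Fin.elim0 (by simp)
    simpa using h
  have hle : ∑ k, w k * A.outputProb (conjMap (U k)) S ≤ 1 / 3 := by
    calc ∑ k, w k * A.outputProb (conjMap (U k)) S ≤ ∑ k, w k * (1 / 3) :=
          Finset.sum_le_sum fun k _ => mul_le_mul_of_nonneg_left (hUk k) (hw k)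
      _ = 1 / 3 := by rw [← Finset.sum_mul, hw1, one_mul]
  nlinarith [mul_le_mul_of_nonneg_left hle hC0]

/-! ### The bound of order `ε⁻²` -/

/-- A chi-square argument along the tree: each node contributes the second moment `∑ p'² / p ≤ 1 + 4
η²` of the likelihood ratio, and Cauchy–Schwarz at the node combines it with the bound for the
subtrees. -/
theorem Strategy.sq_outputProb_le (hd : d ≠ 0) {η : ℝ} (h0 : 0 ≤ η) (S : Set ℝ)
    (s : Strategy d T) :
    s.outputProb (mixedChannel d (1 / 2 + η)) S ^ 2 ≤
      (1 + 4 * η ^ 2) ^ T * s.outputProb (mixedChannel d (1 / 2)) S := by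
  induction s with
  | leaf z =>
    simp only [Strategy.outputProb]
    split_ifs <;> simp
  | @node T e next ih =>
    simp only [Strategy.outputProb]
    set p : Fin e.outcomes → ℝ := fun v => e.prob (mixedChannel d (1 / 2)) v with hp
    set p' : Fin e.outcomes → ℝ := fun v => e.prob (mixedChannel d (1 / 2 + η)) v with hp'
    set x : Fin e.outcomes → ℝ := fun v => (next v).outputProb (mixedChannel d (1 / 2)) S
    set x' : Fin e.outcomes → ℝ := fun v => (next v).outputProb (mixedChannel d (1 / 2 + η)) S
    have hx' : ∀ v, x' v ^ 2 ≤ (1 + 4 * η ^ 2) ^ T * x v := ih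
    have hp0 : ∀ v, 0 ≤ p v := fun v => e.prob_mixedChannel_nonneg (by norm_num) (by norm_num) v
    -- With `a` and `b` the probabilities under the identity and the depolarizing channel, `p' - p =
    -- η (a - b)` while `2 p = a + b`.
    have hdiff : ∀ v, |p' v - p v| ≤ 2 * η * p v := by
      intro v
      have ha := e.prob_conjMap_nonneg 1 v
      have hb := e.prob_mixedChannel_nonneg (q := 0) le_rfl zero_le_one v
      simp only [hp, hp']
      rw [e.prob_mixedChannel (q := 1 / 2 + η), e.prob_mixedChannel (q := 1 / 2), abs_le]
      constructor <;> nlinarith [mul_nonneg h0 ha, mul_nonneg h0 hb]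
    have hsum : ∑ v, p v = 1 := e.sum_prob (isTracePreserving_mixedChannel hd)
    have hsum' : ∑ v, p' v = 1 := e.sum_prob (isTracePreserving_mixedChannel hd)
    have hratio : ∑ v, p' v ^ 2 / p v ≤ 1 + 4 * η ^ 2 := by
      -- This is `(p' - p)² ≤ 4 η² p²` divided by `p`. If `p = 0` then `p' = 0` too, and the
      -- quotient is `0` by convention.
      have h : ∀ v, p' v ^ 2 / p v ≤ 2 * p' v - p v + 4 * η ^ 2 * p v := by
        intro v
        rcases (hp0 v).eq_or_lt with h | h
        · have := hdiff v
          rw [← h, mul_zero, sub_zero] at this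
          have hp'0 : p' v = 0 := abs_nonpos_iff.mp this
          simp [← h, hp'0]
        · rw [div_le_iff₀ h]
          have := sq_le_sq' (abs_le.mp (hdiff v)).1 (abs_le.mp (hdiff v)).2
          nlinarith
      calc ∑ v, p' v ^ 2 / p v ≤ ∑ v, (2 * p' v - p v + 4 * η ^ 2 * p v) :=
            Finset.sum_le_sum fun v _ => h v
        _ = 1 + 4 * η ^ 2 := by
            rw [Finset.sum_add_distrib, Finset.sum_sub_distrib, ← Finset.mul_sum, ← Finset.mul_sum,
              hsum, hsum']
            ring
    have hcs : (∑ v, p' v * x' v) ^ 2 ≤ (∑ v, p' v ^ 2 / p v) * ∑ v, p v * x' v ^ 2 := by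
      refine Finset.sum_sq_le_sum_mul_sum_of_sq_le_mul _
        (fun v _ => div_nonneg (sq_nonneg _) (hp0 v))
        (fun v _ => mul_nonneg (hp0 v) (sq_nonneg _)) fun v _ => ?_
      rcases (hp0 v).eq_or_lt with h | h
      · have := hdiff v
        rw [← h, mul_zero, sub_zero] at this
        have hp'0 : p' v = 0 := abs_nonpos_iff.mp this
        simp [← h, hp'0]
      · refine le_of_eq ?_
        field_simp
    have hlast : ∑ v, p v * x' v ^ 2 ≤ (1 + 4 * η ^ 2) ^ T * ∑ v, p v * x v := by
      rw [Finset.mul_sum]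
      refine Finset.sum_le_sum fun v _ => ?_
      have := mul_le_mul_of_nonneg_left (hx' v) (hp0 v)
      linarith
    calc (∑ v, p' v * x' v) ^ 2 ≤ (∑ v, p' v ^ 2 / p v) * ∑ v, p v * x' v ^ 2 := hcs
      _ ≤ (1 + 4 * η ^ 2) * ((1 + 4 * η ^ 2) ^ T * ∑ v, p v * x v) :=
          mul_le_mul hratio hlast
            (Finset.sum_nonneg fun v _ => mul_nonneg (hp0 v) (sq_nonneg _)) (by positivity)
      _ = _ := by ring

theorem IncoherentAlgorithm.EstimatesUnitarity.inv_sq_le (hd : 2 ≤ d) (hε0 : 0 < ε)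
    (hε : ε ≤ 1 / 12) (A : IncoherentAlgorithm d T) (hA : A.EstimatesUnitarity ε) :
    1 / 144 * (1 / ε ^ 2) ≤ (T : ℝ) := by
  have hd0 : d ≠ 0 := by omega
  have hd' : (2 : ℝ) ≤ d := by exact_mod_cast hd
  set E := mixedChannel d (1 / 2)
  set E' := mixedChannel d (1 / 2 + 3 * ε)
  have hch : IsChannel E := isChannel_mixedChannel hd0 (by norm_num) (by norm_num)
  have hch' : IsChannel E' := isChannel_mixedChannel hd0 (by linarith) (by linarith)
  have htp : IsTracePreserving E := isTracePreserving_mixedChannel hd0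
  have htp' : IsTracePreserving E' := isTracePreserving_mixedChannel hd0
  have hpos : ∀ (e : Experiment d) v, 0 ≤ e.prob E v :=
    fun e v => e.prob_mixedChannel_nonneg (by norm_num) (by norm_num) v
  have hpos' : ∀ (e : Experiment d) v, 0 ≤ e.prob E' v :=
    fun e v => e.prob_mixedChannel_nonneg (by linarith) (by linarith) v
  -- The gap is `(3ε + 9ε²)(1 - 1/d²)`, at least `9ε/4` since `d ≥ 2`; this is why the weights
  -- differ by `3ε`.
  have hu : unitarity E + 2 * ε < unitarity E' := by
    simp only [E, E']
    rw [unitarity_mixedChannel hd0, unitarity_mixedChannel hd0]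
    have h4 : 1 / (d : ℝ) ^ 2 ≤ 1 / 4 := by
      apply one_div_le_one_div_of_le (by norm_num)
      nlinarith
    have h5 : (1 / 2 + 3 * ε) ^ 2 + (1 - (1 / 2 + 3 * ε) ^ 2) / (d : ℝ) ^ 2 -
        ((1 / 2) ^ 2 + (1 - (1 / 2) ^ 2) / (d : ℝ) ^ 2) =
        (3 * ε + 9 * ε ^ 2) * (1 - 1 / (d : ℝ) ^ 2) := by ring
    nlinarith [sq_nonneg ε, mul_le_mul_of_nonneg_left h4 (by positivity : 0 ≤ 3 * ε + 9 * ε ^ 2)]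
  let S := {z : ℝ | |z - unitarity E'| ≤ ε}
  have hS : MeasurableSet S := measurableSet_abs_sub_le _ _
  have h1 : 2 / 3 ≤ A.outputProb E' S := hA _ hch' htp'
  have h2 : A.outputProb E S ≤ 1 / 3 := by
    have h := hA _ hch htp
    have hm := A.outputProb_mono hpos hch htp (measurableSet_abs_sub_le (unitarity E) ε)
      hS.compl (by
        intro z hz hz'
        have h1 : |z - unitarity E| ≤ ε := hz
        have h2 : |z - unitarity E'| ≤ ε := hz'
        rw [abs_le] at h1 h2
        linarith [h1.2, h2.1])
    have hc := A.outputProb_add_compl hpos hch htp hS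
    linarith
  set κ : ℝ := (1 + 4 * (3 * ε) ^ 2) ^ T
  have h3 : A.outputProb E' S ^ 2 ≤ κ * A.outputProb E S := by
    let := A.measurableSpace
    have := A.isProbability
    set M := A.outputProb E' S with hM
    have hi := A.integrable_outputProb hpos hch htp hS
    have hi' := A.integrable_outputProb hpos' hch' htp' hS
    -- Jensen's inequality for the square over the seed, in the tangent form `2 M x - M² ≤ x²` with
    -- `M` the mean.
    have h := integral_mono ((hi'.const_mul (2 * M)).sub (integrable_const (M ^ 2)))
      (hi.const_mul κ) fun ω => by
        have h := (A.strategy ω).sq_outputProb_le hd0 (η := 3 * ε) (by linarith) S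
        change 2 * M * (A.strategy ω).outputProb E' S - M ^ 2 ≤ κ * (A.strategy ω).outputProb E S
        change (A.strategy ω).outputProb E' S ^ 2 ≤ κ * (A.strategy ω).outputProb E S at h
        nlinarith [sq_nonneg ((A.strategy ω).outputProb E' S - M)]
    simp only [Pi.sub_apply] at h
    rw [integral_sub (hi'.const_mul (2 * M)) (integrable_const _), integral_const_mul,
      integral_const_mul] at h
    have e1 : ∫ ω, (A.strategy ω).outputProb E' S ∂A.law = M := rfl
    have e2 : ∫ ω, (A.strategy ω).outputProb E S ∂A.law = A.outputProb E S := rfl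
    rw [e1, e2] at h
    simp at h
    nlinarith
  have hκ0 : 0 < κ := by positivity
  -- From `(2/3)² ≤ κ / 3`. As `κ ≤ exp (36 ε² T)` and `exp (1/4) ≤ 4/3`, it follows that `36 ε² T ≥
  -- 1/4`, whence the constant `1/144`.
  have h4 : 4 / 3 ≤ κ := by nlinarith [mul_le_mul_of_nonneg_left h2 hκ0.le]
  have h5 : κ ≤ Real.exp (T * (36 * ε ^ 2)) := by
    rw [Real.exp_nat_mul]
    refine pow_le_pow_left₀ (by positivity) ?_ T
    have := Real.add_one_le_exp (36 * ε ^ 2)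
    linarith
  have h6 : 1 / 4 ≤ (T : ℝ) * (36 * ε ^ 2) := by
    have h7 : Real.exp (1 / 4) ≤ 4 / 3 := by
      have := Real.one_sub_le_exp_neg (1 / 4)
      rw [Real.exp_neg] at this
      have hp := Real.exp_pos (1 / 4)
      have h8 : (1 - 1 / 4 : ℝ) * Real.exp (1 / 4) ≤ 1 := by
        calc (1 - 1 / 4 : ℝ) * Real.exp (1 / 4) ≤ (Real.exp (1 / 4))⁻¹ * Real.exp (1 / 4) :=
              mul_le_mul_of_nonneg_right this hp.le
          _ = 1 := inv_mul_cancel₀ hp.ne'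
      linarith
    exact Real.exp_le_exp.mp (h7.trans (h4.trans h5))
  rw [mul_one_div, div_le_iff₀ (by positivity)]
  linarith

end Bounds

end UnitarityEstimation

theorem mainTheorem7 :
    ∃ c : ℝ, 0 < c ∧ ∀ d : ℕ, 2 ≤ d → ∀ ε : ℝ, 0 < ε → ε < (1 - 1 / (d : ℝ) ^ 2) / 2 →
      ∀ (T : ℕ) (A : UnitarityEstimation.IncoherentAlgorithm d T),
        A.EstimatesUnitarity ε → c * (Real.sqrt d + 1 / ε ^ 2) ≤ (T : ℝ) := by
  -- Half of `1/144`, so that each of the two terms is at most `T / 2`. For `ε > 1/12` the second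
  -- term is covered by `1 ≤ √d ≤ T`.
  refine ⟨1 / 288, by norm_num, fun d hd ε hε0 hε T A hA => ?_⟩
  have h1 : Real.sqrt d ≤ T := hA.sqrt_le hd hε A
  have h2 : 1 / 144 * (1 / ε ^ 2) ≤ (T : ℝ) := by
    rcases le_or_gt ε (1 / 12) with h | h
    · exact hA.inv_sq_le hd hε0 h A
    · have h3 : (1 : ℝ) ≤ Real.sqrt d :=
        Real.one_le_sqrt.mpr (by exact_mod_cast (by omega : 1 ≤ d))
      have h4 : 1 / ε ^ 2 ≤ 144 := by
        rw [div_le_iff₀ (by positivity)]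
        nlinarith
      linarith
  have h5 : 0 ≤ Real.sqrt d := Real.sqrt_nonneg _
  linarith
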